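/- Let $\mathcal V_{\mathrm{all}}$ be a set of variables; each variable $v$ has a set $T_v$ of values and a default value $\mathrm{init}_v\in T_v$. Let $M=\prod_v T_v$ and $H=\ell^2(M)$. A superoperator is a completely positive linear map $\mathcal E$ on the trace-class operators on $H$ for which there is a $B$ with $\operatorname{tr}\mathcal E(\rho)\le B\operatorname{tr}\rho$ for all positive $\rho$. For a variable $v$, let $v'$ be a fresh copy of $v$ (with space $\ell^2(T_v)$), let $U_v$ be the unitary on $H\otimes\ell^2(T_v)$ that swaps $v$ and $v'$, and put \[ \mathrm{LOCAL}_v(\mathcal E)(\rho)=\operatorname{tr}_{v'}\Bigl(U_v\,\bigl(\mathcal E\otimes\mathrm{id}_{v'}\bigr)\bigl(U_v(\rho\otimes|\mathrm{init}_v\rangle\langle\mathrm{init}_v|)U_v^\dagger\bigr)\,U_v^\dagger\Bigr). \] For a finite set $V$ of variables with elements $v_1,\dots,v_n$, listed in any order, let $\mathrm{LOCAL}_V(\mathcal E)=\mathrm{LOCAL}_{v_1}(\mathrm{LOCAL}_{v_2}(\cdots\mathrm{LOCAL}_{v_n}(\mathcal E)))$. Sums over a set $I$ are unordered sums, and convergence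 of a sum of maps on trace-class operators means pointwise convergence with respect to the trace norm. (i) Let $(\mathcal E_i)_{i\in I}$ be superoperators such that $\sum_{i\in I}\mathcal E_i$ converges. Then $\sum_{i\in I}\mathcal E_i$ is a superoperator, the sum $\sum_{i\in I}\mathrm{LOCAL}_V(\mathcal E_i)$ converges, and \[ \sum_{i\in I}\mathrm{LOCAL}_V(\mathcal E_i)=\mathrm{LOCAL}_V\Bigl(\sum_{i\in I}\mathcal E_i\Bigr). \] (ii) The converse fails: if $I$ is infinite and some $v\in V$ has at least two values, then there are superoperators $(\mathcal E_i)_{i\in I}$ with $\mathrm{LOCAL}_V(\mathcal E_i)=0$ for all $i$, so that $\sum_{i\in I}\mathrm{LOCAL}_V(\mathcal E_i)$ converges, while $\sum_{i\in I}\mathcal E_i$ does not converge. -/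

import Mathlib

open scoped ENNReal ComplexOrder InnerProductSpace
open Filter Topology

namespace LocalVar

noncomputable section

universe u v w

/-- The Hilbert space `ℓ²(X)` with orthonormal basis `|x⟩`, `x ∈ X`. -/
def Ell2 (X : Type u) : Type u := lp (fun _ : X => ℂ) 2

instance (X : Type u) : NormedAddCommGroup (Ell2 X) :=
  inferInstanceAs (NormedAddCommGroup (lp (fun _ : X => ℂ) 2))

instance (X : Type u) : InnerProductSpace ℂ (Ell2 X) :=
  inferInstanceAs (InnerProductSpace ℂ (lp (fun _ : X => ℂ) 2))

instance (X : Type u) : CompleteSpace (Ell2 X) :=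
  inferInstanceAs (CompleteSpace (lp (fun _ : X => ℂ) 2))

/-- Bounded operators on `ℓ²(X)`. -/
abbrev Op (X : Type u) : Type u := Ell2 X →L[ℂ] Ell2 X

/-- The standard orthonormal basis of `ℓ²(X)`. -/
def ketBasis (X : Type u) : HilbertBasis X ℂ (Ell2 X) :=
  ⟨LinearIsometryEquiv.refl ℂ (lp (fun _ : X => ℂ) 2)⟩

/-- The basis vector `|x⟩`. -/
def ket {X : Type u} (x : X) : Ell2 X := ketBasis X x

/-- The trace norm `‖A‖₁ = tr |A|`, where `|A| = √(A† A)`, with values in `[0, ∞]`. -/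
def traceNorm {X : Type u} (A : Op X) : ℝ≥0∞ :=
  ∑' x, ENNReal.ofReal (RCLike.re ⟪ket x, CFC.abs A (ket x)⟫_ℂ)

/-- Trace-class operators: bounded operators with finite trace norm. -/
def IsTraceClass {X : Type u} (A : Op X) : Prop := traceNorm A < ∞

section Aux

variable {X : Type u} {Y : Type v}

theorem ket_orthonormal : Orthonormal ℂ (ket : X → Ell2 X) := (ketBasis X).orthonormal

theorem enorm_sq_eq (f : Ell2 X) : ‖f‖ₑ ^ 2 = ∑' x, ‖⟪ket x, f⟫_ℂ‖ₑ ^ 2 := by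
  have h := lp.hasSum_norm (p := 2) (E := fun _ : X => ℂ) (by norm_num) ((ketBasis X).repr f)
  simp only [ENNReal.toReal_ofNat, Real.rpow_ofNat, HilbertBasis.repr_apply_apply,
    LinearIsometryEquiv.norm_map] at h
  have h3 : ∀ z : ℂ, ‖z‖ₑ ^ 2 = ENNReal.ofReal (‖z‖ ^ 2) := fun z => by
    rw [ENNReal.ofReal_pow (norm_nonneg _), ofReal_norm]
  simp_rw [h3, ket]
  rw [← ENNReal.ofReal_tsum_of_nonneg (fun _ => by positivity) h.summable, h.tsum_eq,
    ENNReal.ofReal_pow (norm_nonneg _), ofReal_norm]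

/-- Bessel families: `∑ |⟨gᵢ, h⟩|² ≤ ‖h‖²`. -/
def Bessel {ι : Type w} (g : ι → Ell2 X) : Prop :=
  ∀ h : Ell2 X, ∑' i, ‖⟪g i, h⟫_ℂ‖ₑ ^ 2 ≤ ‖h‖ₑ ^ 2

theorem bessel_ket (C : Ell2 Y →L[ℂ] Ell2 X) (hC : ‖C‖ ≤ 1) : Bessel (fun y => C (ket y)) := by
  intro h
  have : ∀ y, ⟪C (ket y), h⟫_ℂ = ⟪ket y, ContinuousLinearMap.adjoint C h⟫_ℂ := fun y => by
    rw [ContinuousLinearMap.adjoint_inner_right]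
  simp_rw [this]
  rw [← enorm_sq_eq]
  gcongr
  rw [← ofReal_norm, ← ofReal_norm]
  apply ENNReal.ofReal_le_ofReal
  refine (ContinuousLinearMap.le_opNorm _ _).trans ?_
  rw [LinearIsometryEquiv.norm_map]
  nlinarith [norm_nonneg h]

theorem hs_bessel {ι : Type w} {g : ι → Ell2 X} (hg : Bessel g) (S : Op X) (D : Op X)
    (hS : IsSelfAdjoint S) (hD : ‖D‖ ≤ 1) :
    ∑' i, ‖S (ContinuousLinearMap.adjoint D (g i))‖ₑ ^ 2 ≤ ∑' x, ‖S (ket x)‖ₑ ^ 2 := by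
  have hS' : ContinuousLinearMap.adjoint S = S := hS
  have h1 : ∀ i x, ‖⟪ket x, S (ContinuousLinearMap.adjoint D (g i))⟫_ℂ‖ₑ
      = ‖⟪g i, D (S (ket x))⟫_ℂ‖ₑ := fun i x => by
    rw [← ContinuousLinearMap.adjoint_inner_left, hS',
      ContinuousLinearMap.adjoint_inner_right, ← ofReal_norm, ← ofReal_norm, norm_inner_symm]
  simp_rw [enorm_sq_eq (S (ContinuousLinearMap.adjoint D _)), h1]
  rw [ENNReal.tsum_comm]
  refine ENNReal.tsum_le_tsum fun x => (hg _).trans ?_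
  gcongr
  rw [← ofReal_norm, ← ofReal_norm]
  apply ENNReal.ofReal_le_ofReal
  refine (ContinuousLinearMap.le_opNorm _ _).trans ?_
  nlinarith [norm_nonneg (S (ket x))]

/-- An approximate polar decomposition. -/
theorem approx_polar {𝔄 : Type u} [CStarAlgebra 𝔄] [PartialOrder 𝔄] [StarOrderedRing 𝔄]
    (A : 𝔄) {ε : ℝ} (hε : 0 < ε) :
    ∃ D : 𝔄, ‖D‖ ≤ 1 ∧ ‖A - D * CFC.abs A‖ ≤ ε ∧ ‖CFC.abs A - star D * A‖ ≤ ε := by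
  set P : 𝔄 := CFC.abs A with hP
  have hP0 : 0 ≤ P := CFC.abs_nonneg A
  have hPsa : IsSelfAdjoint P := hP0.isSelfAdjoint
  have hspec : ∀ t ∈ spectrum ℝ P, 0 ≤ t := fun t ht => spectrum_nonneg_of_nonneg hP0 ht
  have hcont : ContinuousOn (fun t : ℝ => (t + ε)⁻¹) (spectrum ℝ P) := by
    apply ContinuousOn.inv₀ (by fun_prop)
    intro t ht
    have := hspec t ht
    positivity
  set R : 𝔄 := cfc (fun t : ℝ => (t + ε)⁻¹) P with hR
  have hRsa : IsSelfAdjoint R := cfc_predicate _ _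
  have hPid : cfc (fun t : ℝ => t) P = P := cfc_id' ℝ P
  have hPR : P * R = cfc (fun t : ℝ => t * (t + ε)⁻¹) P := by
    rw [cfc_mul (fun t : ℝ => t) (fun t : ℝ => (t + ε)⁻¹) P (by fun_prop) hcont, hPid]
  have hRP : R * P = cfc (fun t : ℝ => t * (t + ε)⁻¹) P := by
    rw [← hPR]
    have := (cfc_commute_cfc (fun t : ℝ => (t + ε)⁻¹) (fun t : ℝ => t) P).eq
    rwa [hPid] at this
  have hnPR : ‖P * R‖ ≤ 1 := by
    rw [hPR]
    apply norm_cfc_le zero_le_one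
    intro t ht
    have := hspec t ht
    rw [Real.norm_of_nonneg (by positivity), ← div_eq_mul_inv, div_le_one (by positivity)]
    linarith
  have hone : (1 : 𝔄) - R * P = ε • R := by
    rw [hRP, ← cfc_const_one ℝ P, ← cfc_sub _ _ P (by fun_prop) (by fun_prop),
      hR, ← cfc_smul ε _ P hcont]
    apply cfc_congr
    intro t ht
    have := hspec t ht
    have h2 : t + ε ≠ 0 := by positivity
    simp only [smul_eq_mul]
    field_simp
    ring
  have hsq : star A * A = P * P := (CFC.abs_mul_abs A).symm
  have hAP : ∀ Q : 𝔄, ‖A * Q‖ = ‖P * Q‖ := fun Q => by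
    have h1 : star (A * Q) * (A * Q) = star (P * Q) * (P * Q) := by
      simp only [star_mul, hPsa.star_eq]
      rw [mul_assoc, ← mul_assoc (star A), hsq]
      simp only [mul_assoc]
    have h2 := CStarRing.norm_star_mul_self (x := A * Q)
    have h3 := CStarRing.norm_star_mul_self (x := P * Q)
    rw [h1, h3] at h2
    nlinarith [norm_nonneg (A * Q), norm_nonneg (P * Q)]
  have hD : ‖A * R‖ ≤ 1 := by rw [hAP]; exact hnPR
  refine ⟨A * R, hD, ?_, ?_⟩
  · have : A - A * R * P = ε • (A * R) := by
      rw [← mul_smul_comm, ← hone, mul_sub, mul_one, mul_assoc]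
    rw [this, norm_smul, Real.norm_of_nonneg hε.le]
    nlinarith
  · have : P - star (A * R) * A = ε • (R * P) := by
      rw [star_mul, hRsa.star_eq, mul_assoc, hsq, ← mul_assoc, ← smul_mul_assoc, ← hone, sub_mul,
        one_mul]
    rw [this, norm_smul, Real.norm_of_nonneg hε.le, hRP, ← hPR]
    nlinarith


theorem re_inner_abs (A : Op X) (f : Ell2 X) :
    ENNReal.ofReal (RCLike.re ⟪f, CFC.abs A f⟫_ℂ) = ‖CFC.sqrt (CFC.abs A) f‖ₑ ^ 2 := by
  set S : Op X := CFC.sqrt (CFC.abs A)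
  have hS : S * S = CFC.abs A := CFC.sqrt_mul_sqrt_self _ (CFC.abs_nonneg A)
  have hSsa : IsSelfAdjoint S := (CFC.sqrt_nonneg (CFC.abs A)).isSelfAdjoint
  have hS' : ContinuousLinearMap.adjoint S = S := hSsa
  rw [← hS, mul_apply_eq_comp, ← ContinuousLinearMap.adjoint_inner_left, hS',
    inner_self_eq_norm_sq, ENNReal.ofReal_pow (norm_nonneg _), ofReal_norm]

theorem traceNorm_eq (A : Op X) :
    traceNorm A = ∑' x, ‖CFC.sqrt (CFC.abs A) (ket x)‖ₑ ^ 2 := by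
  simp_rw [traceNorm, re_inner_abs]

theorem tsum_inner_le_traceNorm {ι : Type w} {g l : ι → Ell2 X} (hg : Bessel g) (hl : Bessel l)
    (A : Op X) : ∑' i, ‖⟪g i, A (l i)⟫_ℂ‖ₑ ≤ traceNorm A := by
  rw [ENNReal.tsum_eq_iSup_sum]
  refine iSup_le fun s => ?_
  set c : ℝ≥0∞ := ∑ i ∈ s, ‖g i‖ₑ * ‖l i‖ₑ with hc
  have hctop : c ≠ ∞ := by
    rw [hc, ENNReal.sum_ne_top]
    intro i _
    exact ENNReal.mul_ne_top enorm_ne_top enorm_ne_top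
  have key : ∀ ε : ℝ, 0 < ε →
      ∑ i ∈ s, ‖⟪g i, A (l i)⟫_ℂ‖ₑ ≤ traceNorm A + ENNReal.ofReal ε * c := by
    intro ε hε
    obtain ⟨D, hD, hAD, -⟩ := approx_polar A hε
    set S : Op X := CFC.sqrt (CFC.abs A) with hSdef
    have hS : S * S = CFC.abs A := CFC.sqrt_mul_sqrt_self _ (CFC.abs_nonneg A)
    have hSsa : IsSelfAdjoint S := (CFC.sqrt_nonneg (CFC.abs A)).isSelfAdjoint
    have hS' : ContinuousLinearMap.adjoint S = S := hSsa
    have h1 := hs_bessel hg S D hSsa hD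
    have h2 := hs_bessel hl S 1 hSsa ContinuousLinearMap.norm_id_le
    have hadj1 : ContinuousLinearMap.adjoint (1 : Op X) = 1 := star_one (Op X)
    simp only [hadj1, one_apply_eq_self] at h2
    rw [← traceNorm_eq] at h1 h2
    have hterm : ∀ i, ‖⟪g i, A (l i)⟫_ℂ‖ₑ ≤
        2⁻¹ * (‖S (ContinuousLinearMap.adjoint D (g i))‖ₑ ^ 2 + ‖S (l i)‖ₑ ^ 2) +
          ENNReal.ofReal ε * (‖g i‖ₑ * ‖l i‖ₑ) := by
      intro i
      have e1 : ⟪g i, A (l i)⟫_ℂ = ⟪S (ContinuousLinearMap.adjoint D (g i)), S (l i)⟫_ℂ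
          + ⟪g i, (A - D * CFC.abs A) (l i)⟫_ℂ := by
        rw [← ContinuousLinearMap.adjoint_inner_right, hS', ContinuousLinearMap.adjoint_inner_left,
          ← inner_add_right, ← hS]
        simp
      have e2 : ‖⟪g i, A (l i)⟫_ℂ‖ ≤
          2⁻¹ * (‖S (ContinuousLinearMap.adjoint D (g i))‖ ^ 2 + ‖S (l i)‖ ^ 2) +
          ε * (‖g i‖ * ‖l i‖) := by
        rw [e1]
        refine (norm_add_le _ _).trans (add_le_add ?_ ?_)
        · refine (norm_inner_le_norm _ _).trans ?_
          nlinarith [sq_nonneg (‖S (ContinuousLinearMap.adjoint D (g i))‖ - ‖S (l i)‖)]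
        · refine (norm_inner_le_norm _ _).trans ?_
          have := (A - D * CFC.abs A).le_of_opNorm_le hAD (l i)
          nlinarith [norm_nonneg (g i), norm_nonneg (l i)]
      have e3 := ENNReal.ofReal_le_ofReal e2
      rw [ENNReal.ofReal_add (by positivity) (by positivity), ENNReal.ofReal_mul (by norm_num),
        ENNReal.ofReal_add (by positivity) (by positivity), ENNReal.ofReal_mul hε.le,
        ENNReal.ofReal_mul (norm_nonneg _), ENNReal.ofReal_pow (norm_nonneg _),
        ENNReal.ofReal_pow (norm_nonneg _), ENNReal.ofReal_inv_of_pos (by norm_num)] at e3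
      simpa only [ofReal_norm, ENNReal.ofReal_ofNat] using e3
    refine (Finset.sum_le_sum fun i _ => hterm i).trans ?_
    rw [Finset.sum_add_distrib, ← Finset.mul_sum, ← Finset.mul_sum, Finset.sum_add_distrib]
    gcongr
    calc _ ≤ 2⁻¹ * (traceNorm A + traceNorm A) := by
          gcongr
          · exact (ENNReal.sum_le_tsum s).trans h1
          · exact (ENNReal.sum_le_tsum s).trans h2
      _ = traceNorm A := by
          rw [← two_mul, ← mul_assoc, ENNReal.inv_mul_cancel (by norm_num) (by norm_num), one_mul]
  have hlim : Tendsto (fun ε : ℝ => traceNorm A + ENNReal.ofReal ε * c) (𝓝[>] 0)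
      (𝓝 (traceNorm A + ENNReal.ofReal 0 * c)) := by
    refine Tendsto.mono_left ?_ nhdsWithin_le_nhds
    exact tendsto_const_nhds.add
      (ENNReal.Tendsto.mul_const (ENNReal.continuous_ofReal.tendsto 0) (Or.inr hctop))
  simp only [ENNReal.ofReal_zero, zero_mul, add_zero] at hlim
  exact ge_of_tendsto hlim (by
    filter_upwards [self_mem_nhdsWithin] with ε hε using key ε hε)

theorem traceNorm_le {A : Op X} {c : ℝ≥0∞}
    (h : ∀ C : Op X, ‖C‖ ≤ 1 → ∑' x, ‖⟪C (ket x), A (ket x)⟫_ℂ‖ₑ ≤ c) : traceNorm A ≤ c := by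
  rw [traceNorm, ENNReal.tsum_eq_iSup_sum]
  refine iSup_le fun s => ?_
  have key : ∀ ε : ℝ, 0 < ε →
      ∑ x ∈ s, ENNReal.ofReal (RCLike.re ⟪ket x, CFC.abs A (ket x)⟫_ℂ) ≤
        c + ENNReal.ofReal ε * s.card := by
    intro ε hε
    obtain ⟨D, hD, -, hAD⟩ := approx_polar A hε
    have hterm : ∀ x, ENNReal.ofReal (RCLike.re ⟪ket x, CFC.abs A (ket x)⟫_ℂ) ≤
        ‖⟪D (ket x), A (ket x)⟫_ℂ‖ₑ + ENNReal.ofReal ε := by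
      intro x
      rw [← ofReal_norm, ← ENNReal.ofReal_add (norm_nonneg _) hε.le]
      apply ENNReal.ofReal_le_ofReal
      refine (RCLike.re_le_norm _).trans ?_
      have e1 : ⟪ket x, CFC.abs A (ket x)⟫_ℂ = ⟪D (ket x), A (ket x)⟫_ℂ
          + ⟪ket x, (CFC.abs A - star D * A) (ket x)⟫_ℂ := by
        rw [← ContinuousLinearMap.adjoint_inner_right, ← inner_add_right,
          ContinuousLinearMap.star_eq_adjoint]
        simp
      rw [e1]
      refine (norm_add_le _ _).trans (add_le_add le_rfl ?_)
      refine (norm_inner_le_norm _ _).trans ?_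
      have := (CFC.abs A - star D * A).le_of_opNorm_le hAD (ket x)
      rw [ket_orthonormal.1 x] at this ⊢
      linarith
    refine (Finset.sum_le_sum fun i _ => hterm i).trans ?_
    rw [Finset.sum_add_distrib, Finset.sum_const, nsmul_eq_mul, mul_comm]
    gcongr
    exact (ENNReal.sum_le_tsum s).trans (h D hD)
  have hlim : Tendsto (fun ε : ℝ => c + ENNReal.ofReal ε * s.card) (𝓝[>] 0)
      (𝓝 (c + ENNReal.ofReal 0 * s.card)) := by
    refine Tendsto.mono_left ?_ nhdsWithin_le_nhds
    exact tendsto_const_nhds.add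
      (ENNReal.Tendsto.mul_const (ENNReal.continuous_ofReal.tendsto 0)
        (Or.inr (ENNReal.natCast_ne_top _)))
  simp only [ENNReal.ofReal_zero, zero_mul, add_zero] at hlim
  exact ge_of_tendsto hlim (by
    filter_upwards [self_mem_nhdsWithin] with ε hε using key ε hε)

theorem bessel_ket_self : Bessel (ket : X → Ell2 X) := fun h => (enorm_sq_eq h).ge

theorem traceNorm_add_le (A B : Op X) : traceNorm (A + B) ≤ traceNorm A + traceNorm B := by
  refine traceNorm_le fun C hC => ?_
  calc _ ≤ ∑' x, (‖⟪C (ket x), A (ket x)⟫_ℂ‖ₑ + ‖⟪C (ket x), B (ket x)⟫_ℂ‖ₑ) := by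
        refine ENNReal.tsum_le_tsum fun x => ?_
        rw [add_apply, inner_add_right]
        exact enorm_add_le _ _
    _ ≤ _ := by
        rw [ENNReal.tsum_add]
        exact add_le_add (tsum_inner_le_traceNorm (bessel_ket C hC) bessel_ket_self A)
          (tsum_inner_le_traceNorm (bessel_ket C hC) bessel_ket_self B)

theorem traceNorm_smul_le (c : ℂ) (A : Op X) : traceNorm (c • A) ≤ ‖c‖ₑ * traceNorm A := by
  refine traceNorm_le fun C hC => ?_
  simp only [smul_apply, inner_smul_right, enorm_mul]
  rw [ENNReal.tsum_mul_left]
  gcongr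
  exact tsum_inner_le_traceNorm (bessel_ket C hC) bessel_ket_self A

theorem traceNorm_zero : traceNorm (0 : Op X) = 0 := by
  simp [traceNorm]

theorem traceNorm_conj_le (A : Op X) (K L : Ell2 Y →L[ℂ] Ell2 X) (hK : ‖K‖ ≤ 1) (hL : ‖L‖ ≤ 1) :
    traceNorm (ContinuousLinearMap.adjoint K ∘L A ∘L L) ≤ traceNorm A := by
  refine traceNorm_le fun C hC => ?_
  simp only [ContinuousLinearMap.comp_apply, ContinuousLinearMap.adjoint_inner_right]
  refine tsum_inner_le_traceNorm (bessel_ket (K ∘L C) ?_) (bessel_ket L hL) A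
  refine (ContinuousLinearMap.opNorm_comp_le _ _).trans ?_
  nlinarith [norm_nonneg K, norm_nonneg C]

end Aux

/-- The space `T(X)` of trace-class operators on `ℓ²(X)`. -/
def TraceClass (X : Type u) : Submodule ℂ (Op X) where
  carrier := {A | IsTraceClass A}
  add_mem' {A B} hA hB := (traceNorm_add_le A B).trans_lt (ENNReal.add_lt_top.2 ⟨hA, hB⟩)
  zero_mem' := by
    change traceNorm (0 : Op X) < ∞
    simp [traceNorm_zero]
  smul_mem' c A hA := (traceNorm_smul_le c A).trans_lt (ENNReal.mul_lt_top enorm_lt_top hA)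

/-- The trace `∑ₓ ⟨x|A|x⟩`. -/
def trace {X : Type u} (A : Op X) : ℂ := ∑' x, ⟪ket x, A (ket x)⟫_ℂ

/-- A square matrix of operators on `ℓ²(X)` is positive if it is positive as an operator on
`ℓ²(X) ⊗ ℂⁿ`. -/
def BlockPositive {X : Type u} {n : ℕ} (ρ : Fin n → Fin n → Op X) : Prop :=
  ∀ ψ : Fin n → Ell2 X, 0 ≤ ∑ i, ∑ j, ⟪ψ i, ρ i j (ψ j)⟫_ℂ

/-- Complete positivity: `E ⊗ id` on `T(ℓ²(X) ⊗ ℂⁿ)` preserves positivity for every `n`. -/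
def CompletelyPositive {X : Type u} (E : TraceClass X →ₗ[ℂ] TraceClass X) : Prop :=
  ∀ (n : ℕ) (ρ : Fin n → Fin n → TraceClass X),
    BlockPositive (fun i j => (ρ i j : Op X)) → BlockPositive (fun i j => (E (ρ i j) : Op X))

/-- A superoperator is a completely positive linear map on the trace-class operators such that, for
some `B`, `tr E(ρ) ≤ B tr ρ` for all positive `ρ`. -/
structure Superoperator (X : Type u) where
  toLinearMap : TraceClass X →ₗ[ℂ] TraceClass X
  completelyPositive : CompletelyPositive toLinearMap
  traceBounded : ∃ B : ℝ, ∀ ρ : TraceClass X, (ρ : Op X).IsPositive →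
    (trace (toLinearMap ρ : Op X)).re ≤ B * (trace (ρ : Op X)).re

instance (X : Type u) : CoeFun (Superoperator X) (fun _ => TraceClass X → TraceClass X) :=
  ⟨fun E => E.toLinearMap⟩

/-- The isometry `ℓ²(X) → ℓ²(Y)`, `|x⟩ ↦ |f x⟩`, for an injection `f`. -/
def basisIsometry {X : Type u} {Y : Type v} (f : X → Y) (hf : Function.Injective f) :
    Ell2 X →ₗᵢ[ℂ] Ell2 Y :=
  (ket_orthonormal.comp f hf).orthogonalFamily.linearIsometry.comp
    (ketBasis X).repr.toLinearIsometry

/-- `basisIsometry` as a bounded operator. -/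
def basisOp {X : Type u} {Y : Type v} (f : X → Y) (hf : Function.Injective f) :
    Ell2 X →L[ℂ] Ell2 Y := (basisIsometry f hf).toContinuousLinearMap

theorem basisOp_ket {X : Type u} {Y : Type v} (f : X → Y) (hf : Function.Injective f) (x : X) :
    basisOp f hf (ket x) = ket (f x) := by
  classical
  change (ket_orthonormal.comp f hf).orthogonalFamily.linearIsometry
    ((ketBasis X).repr (ketBasis X x)) = _
  rw [HilbertBasis.repr_self, OrthogonalFamily.linearIsometry_apply_single]
  simp

theorem basisOp_norm_le {X : Type u} {Y : Type v} (f : X → Y) (hf : Function.Injective f) :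
    ‖basisOp f hf‖ ≤ 1 := (basisIsometry f hf).norm_toContinuousLinearMap_le

/-- `K† A L`, for contractions `K` and `L`. -/
def sandwich {X : Type u} {Y : Type v} (K L : Ell2 Y →L[ℂ] Ell2 X) (hK : ‖K‖ ≤ 1) (hL : ‖L‖ ≤ 1)
    (A : TraceClass X) : TraceClass Y :=
  ⟨ContinuousLinearMap.adjoint K ∘L (A : Op X) ∘L L,
    (traceNorm_conj_le (A : Op X) K L hK hL).trans_lt A.2⟩

section Tensor

variable {X : Type u} {Y : Type v}

/-- The isometry `id ⊗ |y⟩ : ℓ²(X) → ℓ²(X) ⊗ ℓ²(Y) = ℓ²(X × Y)`. -/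
def tensorKet (y : Y) : Ell2 X →L[ℂ] Ell2 (X × Y) :=
  basisOp (fun x => (x, y)) (Prod.mk_left_injective y)

theorem tensorKet_norm_le (y : Y) : ‖(tensorKet y : Ell2 X →L[ℂ] Ell2 (X × Y))‖ ≤ 1 :=
  basisOp_norm_le _ _

/-- The block `(id ⊗ ⟨y|) ρ (id ⊗ |y'⟩)` of an operator `ρ` on `ℓ²(X) ⊗ ℓ²(Y)`. -/
def block (y y' : Y) (ρ : TraceClass (X × Y)) : TraceClass X :=
  sandwich (tensorKet y) (tensorKet y') (tensorKet_norm_le y) (tensorKet_norm_le y') ρ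

/-- `ρ ↦ ρ ⊗ |y⟩⟨y| = (id ⊗ |y⟩) ρ (id ⊗ ⟨y|)`. -/
def tensorPure (y : Y) (ρ : TraceClass X) : TraceClass (X × Y) :=
  sandwich (ContinuousLinearMap.adjoint (tensorKet y)) (ContinuousLinearMap.adjoint (tensorKet y))
    (by rw [LinearIsometryEquiv.norm_map]; exact tensorKet_norm_le y)
    (by rw [LinearIsometryEquiv.norm_map]; exact tensorKet_norm_le y) ρ

theorem bessel_tensorKet (C : Op X) (hC : ‖C‖ ≤ 1) :
    Bessel (fun p : X × Y => tensorKet p.2 (C (ket p.1))) := by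
  intro h
  rw [ENNReal.tsum_prod', ENNReal.tsum_comm]
  have h1 : ∀ y : Y, ∑' x : X, ‖⟪(tensorKet y (C (ket x)) : Ell2 (X × Y)), h⟫_ℂ‖ₑ ^ 2 ≤
      ∑' x : X, ‖⟪ket (x, y), h⟫_ℂ‖ₑ ^ 2 := by
    intro y
    have h2 := bessel_ket C hC (ContinuousLinearMap.adjoint (tensorKet y) h)
    simp only [ContinuousLinearMap.adjoint_inner_right] at h2
    refine h2.trans_eq ?_
    rw [enorm_sq_eq]
    simp only [ContinuousLinearMap.adjoint_inner_right, tensorKet, basisOp_ket]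
  refine (ENNReal.tsum_le_tsum h1).trans_eq ?_
  rw [ENNReal.tsum_comm, enorm_sq_eq h, ENNReal.tsum_prod']

theorem traceNorm_tsum_le (ρ : Op (X × Y)) :
    traceNorm (∑' y : Y, ContinuousLinearMap.adjoint (tensorKet y) ∘L ρ ∘L tensorKet y : Op X) ≤
      traceNorm ρ := by
  by_cases hs : Summable
      (fun y : Y => (ContinuousLinearMap.adjoint (tensorKet y) ∘L ρ ∘L tensorKet y : Op X))
  · refine traceNorm_le fun C hC => ?_
    have h1 : ∀ x : X, ‖⟪C (ket x), (∑' y : Y, ContinuousLinearMap.adjoint (tensorKet y) ∘L ρ ∘L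
        tensorKet y : Op X) (ket x)⟫_ℂ‖ₑ ≤
        ∑' y : Y, ‖⟪(tensorKet y (C (ket x)) : Ell2 (X × Y)), ρ (tensorKet y (ket x))⟫_ℂ‖ₑ := by
      intro x
      have h2 := (hs.hasSum.mapL (ContinuousLinearMap.apply ℂ (Ell2 X) (ket x))).mapL
        (innerSL ℂ (C (ket x)))
      simp only [ContinuousLinearMap.apply_apply, ContinuousLinearMap.comp_apply,
        innerSL_apply_apply, ContinuousLinearMap.adjoint_inner_right] at h2
      rw [← h2.tsum_eq]
      exact enorm_tsum_le_tsum_enorm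
    refine (ENNReal.tsum_le_tsum h1).trans ?_
    have h3 := tsum_inner_le_traceNorm (bessel_tensorKet (Y := Y) C hC)
      (bessel_tensorKet (1 : Op X) ContinuousLinearMap.norm_id_le) ρ
    rw [ENNReal.tsum_prod'] at h3
    exact h3
  · rw [tsum_eq_zero_of_not_summable hs, traceNorm_zero]
    exact zero_le

theorem summable_partialTrace (ρ : TraceClass (X × Y)) : Summable fun y : Y =>
    (ContinuousLinearMap.adjoint (tensorKet y) ∘L (ρ : Op (X × Y)) ∘L tensorKet y : Op X) := by
  set a : Y → Op X := fun y =>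
    ContinuousLinearMap.adjoint (tensorKet y) ∘L (ρ : Op (X × Y)) ∘L tensorKet y with ha
  have hortho : ∀ g : Y → Ell2 X, (∀ y, ‖g y‖ ≤ 1) →
      Bessel (fun y => (tensorKet y (g y) : Ell2 (X × Y))) := by
    intro g hg h
    rw [enorm_sq_eq h, ENNReal.tsum_prod', ENNReal.tsum_comm]
    refine ENNReal.tsum_le_tsum fun y => ?_
    have h1 : ∑' x : X, ‖⟪ket (x, y), h⟫_ℂ‖ₑ ^ 2 =
        ‖ContinuousLinearMap.adjoint (tensorKet y : Ell2 X →L[ℂ] _) h‖ₑ ^ 2 := by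
      rw [enorm_sq_eq]
      simp only [ContinuousLinearMap.adjoint_inner_right, tensorKet, basisOp_ket]
    rw [h1, ← ContinuousLinearMap.adjoint_inner_right, ← ofReal_norm, ← ofReal_norm]
    gcongr
    refine (norm_inner_le_norm _ _).trans ?_
    exact mul_le_of_le_one_left (norm_nonneg _) (hg y)
  have hhalf : ∀ y, ∃ g l : Ell2 X, ‖g‖ ≤ 1 ∧ ‖l‖ ≤ 1 ∧ ‖a y‖ / 2 ≤ ‖⟪g, a y l⟫_ℂ‖ := by
    intro y
    rcases (norm_nonneg (a y)).eq_or_lt with h0 | h0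
    · exact ⟨0, 0, by simp, by simp, by simp [← h0]⟩
    obtain ⟨l, hl, hl2⟩ := (a y).exists_lt_apply_of_lt_opNorm (half_lt_self h0)
    have hpos : 0 < ‖a y l‖ := lt_trans (by positivity) hl2
    refine ⟨((‖a y l‖⁻¹ : ℝ) : ℂ) • a y l, l, ?_, hl.le, ?_⟩
    · rw [norm_smul, Complex.norm_real, norm_inv, norm_norm, inv_mul_cancel₀ hpos.ne']
    · rw [inner_smul_left, inner_self_eq_norm_sq_to_K, norm_mul]
      simp only [Complex.conj_ofReal, Complex.norm_real, norm_inv, norm_norm, norm_pow,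
        Complex.coe_algebraMap]
      rw [sq, ← mul_assoc, inv_mul_cancel₀ hpos.ne', one_mul]
      exact hl2.le
  choose g l hg hl hgl using hhalf
  have h1 := tsum_inner_le_traceNorm (hortho g hg) (hortho l hl) (ρ : Op (X × Y))
  have h2 : ∑' y, ‖⟪g y, a y (l y)⟫_ℂ‖ₑ ≠ ∞ := by
    refine ((le_of_eq ?_).trans h1).trans_lt ρ.2 |>.ne
    simp only [ha, ContinuousLinearMap.comp_apply, ContinuousLinearMap.adjoint_inner_right]
  have h3 : Summable fun y => ‖⟪g y, a y (l y)⟫_ℂ‖ := by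
    simpa using ENNReal.summable_toReal h2
  refine Summable.of_norm_bounded (h3.mul_left 2) fun y => ?_
  linarith [hgl y]

/-- The partial trace `tr_Y ρ = ∑_y (id ⊗ ⟨y|) ρ (id ⊗ |y⟩)` (for trace-class `ρ` the series
converges absolutely in operator norm, see `summable_partialTrace`). -/
def partialTrace (ρ : TraceClass (X × Y)) : TraceClass X :=
  ⟨∑' y : Y, ContinuousLinearMap.adjoint (tensorKet y) ∘L (ρ : Op (X × Y)) ∘L tensorKet y,
    (traceNorm_tsum_le (ρ : Op (X × Y))).trans_lt ρ.2⟩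

theorem block_ext {ρ σ : TraceClass (X × Y)} (h : ∀ y y', block y y' ρ = block y y' σ) :
    ρ = σ := by
  have h1 : ∀ p q : X × Y, ⟪ket p, (ρ : Op (X × Y)) (ket q)⟫_ℂ =
      ⟪ket p, (σ : Op (X × Y)) (ket q)⟫_ℂ := by
    rintro ⟨x, y⟩ ⟨x', y'⟩
    have := congrArg (fun τ : TraceClass X => ⟪ket x, (τ : Op X) (ket x')⟫_ℂ) (h y y')
    simpa only [block, sandwich, ContinuousLinearMap.comp_apply, tensorKet, basisOp_ket,
      ContinuousLinearMap.adjoint_inner_right] using this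
  have h2 : ∀ q : X × Y, (ρ : Op (X × Y)) (ket q) = (σ : Op (X × Y)) (ket q) := fun q => by
    refine (ketBasis (X × Y)).repr.injective (lp.ext (funext fun p => ?_))
    rw [HilbertBasis.repr_apply_apply, HilbertBasis.repr_apply_apply]
    exact h1 p q
  refine Subtype.ext (ContinuousLinearMap.ext_on (s := Set.range (ket : X × Y → _)) ?_ ?_)
  · rw [← Submodule.dense_iff_topologicalClosure_eq_top.symm.eq]
    exact (ketBasis (X × Y)).dense_span
  · rintro _ ⟨q, rfl⟩
    exact h2 q

open Classical in
/-- `E ⊗ id_Y` on trace-class operators on `ℓ²(X) ⊗ ℓ²(Y)`: the operator `(E ⊗ id_Y)(ρ)` is the one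
whose `(y, y')`-block is `E` applied to the `(y, y')`-block of `ρ`. An operator is determined by its
blocks, and for a superoperator `E` such a trace-class operator exists for every `ρ`. -/
def tensorId (E : TraceClass X → TraceClass X) (ρ : TraceClass (X × Y)) : TraceClass (X × Y) :=
  if h : ∃ σ : TraceClass (X × Y), ∀ y y', block y y' σ = E (block y y' ρ) then h.choose else 0

theorem tensorId_eq {E : TraceClass X → TraceClass X} {ρ σ : TraceClass (X × Y)}
    (h : ∀ y y', block y y' σ = E (block y y' ρ)) : tensorId E ρ = σ := by
  have hex : ∃ σ : TraceClass (X × Y), ∀ y y', block y y' σ = E (block y y' ρ) := ⟨σ, h⟩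
  rw [tensorId, dif_pos hex]
  exact block_ext fun y y' => (hex.choose_spec y y').trans (h y y').symm

end Tensor

section Local

variable {Var : Type u} {T : Var → Type v}

/-- Memories: assignments of a value to each variable. -/
abbrev Mem (T : Var → Type v) : Type (max u v) := ∀ x, T x

open Classical in
/-- Swapping the contents of the variable `x` with those of a fresh copy of it. -/
def swapMem (x : Var) (p : Mem T × T x) : Mem T × T x := (Function.update p.1 x p.2, p.1 x)

theorem swapMem_involutive (x : Var) : Function.Involutive (swapMem (T := T) x) := by
  intro p
  simp [swapMem]

/-- Conjugation `ρ ↦ U ρ U†` with the unitary `U` that swaps `x` and its fresh copy. -/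
def swapConj (x : Var) (ρ : TraceClass (Mem T × T x)) : TraceClass (Mem T × T x) :=
  sandwich (ContinuousLinearMap.adjoint (basisOp (swapMem x) (swapMem_involutive x).injective))
    (ContinuousLinearMap.adjoint (basisOp (swapMem x) (swapMem_involutive x).injective))
    (by rw [LinearIsometryEquiv.norm_map]; exact basisOp_norm_le _ _)
    (by rw [LinearIsometryEquiv.norm_map]; exact basisOp_norm_le _ _) ρ

/-- `LOCAL_x(E)`: adjoin a fresh copy `x'` of `x` in the default state, swap `x` and `x'`, apply
`E ⊗ id_{x'}`, swap back, and trace out `x'`. -/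
def localVar (init : Mem T) (x : Var) (E : TraceClass (Mem T) → TraceClass (Mem T)) :
    TraceClass (Mem T) → TraceClass (Mem T) :=
  fun ρ => partialTrace (swapConj x (tensorId E (swapConj x (tensorPure (init x) ρ))))

/-- `LOCAL_{x₁,…,xₙ}(E) = LOCAL_{x₁}(LOCAL_{x₂}(… LOCAL_{xₙ}(E)))`. -/
def localVars (init : Mem T) (xs : List Var) (E : TraceClass (Mem T) → TraceClass (Mem T)) :
    TraceClass (Mem T) → TraceClass (Mem T) :=
  xs.foldr (localVar init) E

end Local

section Sums

variable {X : Type u} {I : Type w}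

/-- Trace-norm convergence of the unordered series `∑ᵢ ρᵢ` to `σ`. -/
def TraceSum (ρ : I → TraceClass X) (σ : TraceClass X) : Prop :=
  Tendsto (fun F : Finset I => traceNorm ((∑ i ∈ F, ρ i - σ : TraceClass X) : Op X)) atTop (𝓝 0)

/-- `∑ᵢ Eᵢ` converges to `S`, pointwise in trace norm. -/
def SumsTo (E : I → TraceClass X → TraceClass X) (S : TraceClass X → TraceClass X) : Prop :=
  ∀ ρ, TraceSum (fun i => E i ρ) (S ρ)

/-- `∑ᵢ Eᵢ` converges pointwise in trace norm. -/
def SumConverges (E : I → TraceClass X → TraceClass X) : Prop :=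
  ∃ S : TraceClass X → TraceClass X, SumsTo E S

end Sums

end

end LocalVar

open LocalVar

/-! (i) Everything rests on positivity. A positive linear map on trace-class operators is
automatically bounded on positive operators (`exists_traceNorm_map_le`), so a completely positive
map is a superoperator without further checks. If `∑ Eᵢ` converges pointwise to `S`, then for each
finite `F` the remainder `S - ∑_{i∈F} Eᵢ` is a limit of finite sums of the `Eᵢ`, hence completely
positive (`isCP_sub_sum`); `F = ∅` shows that `S` is a superoperator.

Of the maps composing `LOCAL_v`, only `E ⊗ id` depends on `E`; the others are fixed, and the swap
and the partial trace do not increase the trace norm. So it suffices that `∑ Eᵢ ⊗ id` converges to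
`S ⊗ id` (`SumsTo.tensorId`). Positive operators span, so let `ρ ≥ 0`. The trace norm of a positive
operator is the sum of those of its diagonal blocks, so the error at `F` is `∑_y ‖(S - ∑_{i∈F}
Eᵢ)(ρ_yy)‖₁`. Each term tends to `0` and is at most `‖S(ρ_yy)‖₁`, which is summable; dominated
convergence finishes. Since `LOCAL_v` of a completely positive map is completely positive, induction
on the list of variables applies.

The analytic work is the existence of `E ⊗ id` (`exists_tensorId`): the blocks `E(ρ_yy')` must
assemble to a trace-class operator, possibly with infinitely many `y`.

(ii) Take a memory `z` with `z x ≠ init x` and let every `Eᵢ` be `ρ ↦ |z⟩⟨z| ρ |z⟩⟨z|`. This map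
annihilates operators whose input has `x` in its default state, a property (`KillsInit`) that every
`LOCAL_w` preserves and that makes `LOCAL_x` vanish. The constant series diverges at `|z⟩⟨z|`. -/

namespace LocalVar

noncomputable section

universe u v w

/-! ### Trace norm and positivity; automatic boundedness of positive maps. -/

section TraceNorm

variable {X : Type u} {Y : Type v}

theorem nonneg_iff_inner (A : Op X) : 0 ≤ A ↔ ∀ f, 0 ≤ ⟪f, A f⟫_ℂ := by
  rw [ContinuousLinearMap.nonneg_iff_isPositive]
  refine ⟨fun h f => h.inner_nonneg_right f, fun h => ?_⟩
  rw [ContinuousLinearMap.isPositive_iff_complex]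
  intro f
  have h1 := h f
  rw [← inner_conj_symm, Complex.le_def] at h1
  simp only [Complex.zero_re, Complex.conj_re, Complex.zero_im, Complex.conj_im] at h1
  refine ⟨Complex.ext (by simp) ?_, h1.1⟩
  simp only [RCLike.re_to_complex]
  change (0 : ℝ) = _
  linarith [h1.2]

theorem traceNorm_of_nonneg {A : Op X} (hA : 0 ≤ A) :
    traceNorm A = ∑' x, ENNReal.ofReal (RCLike.re ⟪ket x, A (ket x)⟫_ℂ) := by
  rw [traceNorm, CFC.abs_of_nonneg A hA]

theorem re_inner_nonneg {A : Op X} (hA : 0 ≤ A) (f : Ell2 X) : 0 ≤ RCLike.re ⟪f, A f⟫_ℂ :=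
  (Complex.le_def.1 ((nonneg_iff_inner A).1 hA f)).1

theorem traceNorm_add_of_nonneg {A B : Op X} (hA : 0 ≤ A) (hB : 0 ≤ B) :
    traceNorm (A + B) = traceNorm A + traceNorm B := by
  rw [traceNorm_of_nonneg hA, traceNorm_of_nonneg hB, traceNorm_of_nonneg (add_nonneg hA hB),
    ← ENNReal.tsum_add]
  refine tsum_congr fun x => ?_
  rw [add_apply, inner_add_right, map_add,
    ENNReal.ofReal_add (re_inner_nonneg hA _) (re_inner_nonneg hB _)]

theorem traceNorm_mono {A B : Op X} (hA : 0 ≤ A) (hAB : A ≤ B) : traceNorm A ≤ traceNorm B := by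
  have h := traceNorm_add_of_nonneg hA (sub_nonneg.2 hAB)
  rw [add_sub_cancel] at h
  rw [h]
  exact le_self_add

theorem traceNorm_smul (c : ℂ) (A : Op X) : traceNorm (c • A) = ‖c‖ₑ * traceNorm A := by
  refine (traceNorm_smul_le c A).antisymm ?_
  rcases eq_or_ne c 0 with rfl | hc
  · simp
  have h := traceNorm_smul_le c⁻¹ (c • A)
  rw [inv_smul_smul₀ hc, enorm_inv hc] at h
  calc ‖c‖ₑ * traceNorm A ≤ ‖c‖ₑ * (‖c‖ₑ⁻¹ * traceNorm (c • A)) := by gcongr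
    _ = traceNorm (c • A) := by
      rw [← mul_assoc, ENNReal.mul_inv_cancel (by simpa using hc) enorm_ne_top, one_mul]

theorem traceNorm_neg (A : Op X) : traceNorm (-A) = traceNorm A := by
  rw [traceNorm, traceNorm, CFC.abs_neg]

/-- A single vector of norm at most one is a Bessel family, so `tsum_inner_le_traceNorm` bounds
every matrix coefficient `⟨g, A f⟩` between unit vectors; the choice `g = A f / ‖A f‖` then gives
the operator norm. -/
theorem enorm_le_traceNorm (A : Op X) : ‖A‖ₑ ≤ traceNorm A := by
  rcases eq_or_ne (traceNorm A) ∞ with h | h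
  · simp [h]
  have hb : ∀ g : Ell2 X, ‖g‖ ≤ 1 → Bessel (fun _ : Unit => g) := by
    intro g hg f
    rw [tsum_fintype, Fintype.sum_unique, ← ofReal_norm, ← ofReal_norm]
    gcongr
    exact (norm_inner_le_norm _ _).trans (mul_le_of_le_one_left (norm_nonneg _) hg)
  have key : ∀ f g : Ell2 X, ‖f‖ = 1 → ‖g‖ = 1 → ‖⟪A f, g⟫_ℂ‖ ≤ (traceNorm A).toReal := by
    intro f g hf hg
    have h1 := tsum_inner_le_traceNorm (hb g hg.le) (hb f hf.le) A
    rw [tsum_fintype, Fintype.sum_unique] at h1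
    rw [norm_inner_symm]
    have h2 := ENNReal.toReal_mono h h1
    simpa using h2
  rw [← ofReal_norm]
  refine ENNReal.ofReal_le_of_le_toReal ?_
  refine ContinuousLinearMap.opNorm_le_bound _ ENNReal.toReal_nonneg fun f => ?_
  rcases eq_or_ne f 0 with rfl | hf
  · simp
  rcases eq_or_ne (A f) 0 with h0 | h0
  · rw [h0, norm_zero]; positivity
  have h1 := key ((‖f‖⁻¹ : ℂ) • f) ((‖A f‖⁻¹ : ℂ) • A f) (norm_smul_inv_norm hf)
    (norm_smul_inv_norm h0)
  rw [map_smul, inner_smul_left, inner_smul_right, inner_self_eq_norm_sq_to_K] at h1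
  simp only [norm_mul, RCLike.norm_conj, norm_inv, Complex.norm_real, norm_norm, norm_pow,
    Complex.coe_algebraMap] at h1
  have hf' : 0 < ‖f‖ := norm_pos_iff.2 hf
  have hA' : 0 < ‖A f‖ := norm_pos_iff.2 h0
  rw [show ‖f‖⁻¹ * (‖A f‖⁻¹ * ‖A f‖ ^ 2) = ‖A f‖ / ‖f‖ by field_simp] at h1
  exact (div_le_iff₀ hf').1 h1

theorem traceNorm_star_le (A : Op X) : traceNorm (star A) ≤ traceNorm A := by
  refine traceNorm_le fun C hC => ?_
  have h := tsum_inner_le_traceNorm bessel_ket_self (bessel_ket C hC) A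
  refine le_trans (le_of_eq (tsum_congr fun x => ?_)) h
  rw [ContinuousLinearMap.star_eq_adjoint, ContinuousLinearMap.adjoint_inner_right,
    ← ofReal_norm, ← ofReal_norm, norm_inner_symm]

theorem traceNorm_le_tsum {ι : Type w} {a : ι → Op X} {s : Op X} (h : HasSum a s) :
    traceNorm s ≤ ∑' i, traceNorm (a i) := by
  refine traceNorm_le fun C hC => ?_
  have h1 : ∀ x, ‖⟪C (ket x), s (ket x)⟫_ℂ‖ₑ ≤ ∑' i, ‖⟪C (ket x), a i (ket x)⟫_ℂ‖ₑ := by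
    intro x
    have h2 := (h.mapL (ContinuousLinearMap.apply ℂ (Ell2 X) (ket x))).mapL
      (innerSL ℂ (C (ket x)))
    simp only [ContinuousLinearMap.apply_apply, innerSL_apply_apply] at h2
    rw [← h2.tsum_eq]
    exact enorm_tsum_le_tsum_enorm
  refine (ENNReal.tsum_le_tsum h1).trans ?_
  rw [ENNReal.tsum_comm]
  exact ENNReal.tsum_le_tsum fun i =>
    tsum_inner_le_traceNorm (bessel_ket C hC) bessel_ket_self (a i)

/-- Translates the trace bound in `Superoperator` into a trace-norm bound on positive operators. -/
theorem trace_re_of_nonneg {A : Op X} (hA : 0 ≤ A) : (trace A).re = (traceNorm A).toReal := by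
  have h : ∀ x, ⟪ket x, A (ket x)⟫_ℂ = ((RCLike.re ⟪ket x, A (ket x)⟫_ℂ : ℝ) : ℂ) := fun x =>
    Complex.ext (by simp) (by
      have := (Complex.le_def.1 ((nonneg_iff_inner A).1 hA (ket x))).2
      simpa using this.symm)
  rw [trace, tsum_congr h, ← Complex.ofReal_tsum, Complex.ofReal_re, traceNorm_of_nonneg hA,
    ENNReal.tsum_toReal_eq fun x => ENNReal.ofReal_ne_top]
  exact tsum_congr fun x => (ENNReal.toReal_ofReal (re_inner_nonneg hA _)).symm

theorem eq_zero_of_traceNorm_eq_zero {A : Op X} (h : traceNorm A = 0) : A = 0 := by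
  have := enorm_le_traceNorm A
  rw [h] at this
  simpa using this

theorem TraceClass.induction_selfAdjoint {P : TraceClass X → Prop}
    (pos : ∀ ρ : TraceClass X, 0 ≤ (ρ : Op X) → P ρ) (add : ∀ ρ σ, P ρ → P σ → P (ρ + σ))
    (smul : ∀ (c : ℂ) ρ, P ρ → P (c • ρ)) (ρ : TraceClass X) (hρ : IsSelfAdjoint (ρ : Op X)) :
    P ρ := by
  have habs : CFC.abs (ρ : Op X) ∈ TraceClass X := by
    change traceNorm _ < ∞
    rw [traceNorm, CFC.cfcAbs_cfcAbs]
    exact ρ.2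
  let α : TraceClass X := ⟨_, habs⟩
  -- `|ρ| + ρ` and `|ρ| - ρ` are twice the positive and the negative part of `ρ`.
  have h1 : 0 ≤ ((α + ρ : TraceClass X) : Op X) := by
    change 0 ≤ CFC.abs (ρ : Op X) + (ρ : Op X)
    rw [CFC.abs_add_self _ hρ]
    exact nsmul_nonneg (CFC.posPart_nonneg _) 2
  have h2 : 0 ≤ ((α - ρ : TraceClass X) : Op X) := by
    change 0 ≤ CFC.abs (ρ : Op X) - (ρ : Op X)
    rw [CFC.abs_sub_self _ hρ]
    exact nsmul_nonneg (CFC.negPart_nonneg _) 2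
  have h3 : ρ = (2⁻¹ : ℂ) • (α + ρ) + (-2⁻¹ : ℂ) • (α - ρ) := by module
  rw [h3]
  exact add _ _ (smul _ _ (pos _ h1)) (smul _ _ (pos _ h2))

/-- Trace-class operators are spanned by the positive ones. -/
theorem TraceClass.induction_nonneg {P : TraceClass X → Prop}
    (pos : ∀ ρ : TraceClass X, 0 ≤ (ρ : Op X) → P ρ) (add : ∀ ρ σ, P ρ → P σ → P (ρ + σ))
    (smul : ∀ (c : ℂ) ρ, P ρ → P (c • ρ)) (ρ : TraceClass X) : P ρ := by
  let τ : TraceClass X := ⟨star (ρ : Op X), (traceNorm_star_le _).trans_lt ρ.2⟩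
  have h1 : IsSelfAdjoint ((ρ + τ : TraceClass X) : Op X) := IsSelfAdjoint.add_star_self _
  have h2 : IsSelfAdjoint ((Complex.I • (ρ - τ) : TraceClass X) : Op X) := by
    change star (Complex.I • ((ρ : Op X) - star (ρ : Op X))) = _
    rw [star_smul, star_sub, star_star]
    change _ = Complex.I • ((ρ : Op X) - star (ρ : Op X))
    simp only [RCLike.star_def, Complex.conj_I]
    module
  have h3 : ρ = (2⁻¹ : ℂ) • (ρ + τ) + (-(2⁻¹ * Complex.I)) • (Complex.I • (ρ - τ)) := by
    have h4 : (-(2⁻¹ * Complex.I)) * Complex.I = 2⁻¹ := by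
      rw [neg_mul, mul_assoc, Complex.I_mul_I]; ring
    rw [smul_smul, h4]
    module
  rw [h3]
  exact add _ _ (smul _ _ (TraceClass.induction_selfAdjoint pos add smul _ h1))
    (smul _ _ (TraceClass.induction_selfAdjoint pos add smul _ h2))

/-- A positive linear map between spaces of trace-class operators is bounded on positive
operators. -/
theorem exists_traceNorm_map_le (L : TraceClass X →ₗ[ℂ] TraceClass Y)
    (hL : ∀ ρ : TraceClass X, 0 ≤ (ρ : Op X) → 0 ≤ (L ρ : Op Y)) :
    ∃ B : NNReal, ∀ ρ : TraceClass X, 0 ≤ (ρ : Op X) →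
      traceNorm (L ρ : Op Y) ≤ B * traceNorm (ρ : Op X) := by
  by_contra! hcon
  -- Gliding hump: rescaled to trace norm `2⁻ⁿ`, the counterexample for the constant `4ⁿ` still has
  -- an image of trace norm at least `2ⁿ`, while the rescaled operators `σ n` have a trace-class sum
  -- `τ`.
  choose ρ hρ hlt using fun n : ℕ => hcon (4 ^ n)
  have hfin : ∀ n, traceNorm (ρ n : Op X) ≠ ∞ := fun n => (ρ n).2.ne
  have hne : ∀ n, traceNorm (ρ n : Op X) ≠ 0 := by
    intro n h0
    have h1 : ρ n = 0 := Subtype.ext (eq_zero_of_traceNorm_eq_zero h0)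
    have h2 := hlt n
    rw [h1, map_zero] at h2
    simp [traceNorm_zero] at h2
  have hpos : ∀ n, 0 < (traceNorm (ρ n : Op X)).toReal := fun n =>
    ENNReal.toReal_pos (hne n) (hfin n)
  let c : ℕ → ℝ := fun n => (2 ^ n * (traceNorm (ρ n : Op X)).toReal)⁻¹
  have hc : ∀ n, 0 < c n := fun n => by
    have := hpos n
    positivity
  have hce : ∀ n, ‖(c n : ℂ)‖ₑ = (2 ^ n * traceNorm (ρ n : Op X))⁻¹ := by
    intro n
    rw [← ofReal_norm, Complex.norm_real, Real.norm_of_nonneg (hc n).le,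
      ENNReal.ofReal_inv_of_pos (mul_pos (by positivity) (hpos n)),
      ENNReal.ofReal_mul (by positivity), ENNReal.ofReal_toReal (hfin n),
      ENNReal.ofReal_pow (by norm_num), ENNReal.ofReal_ofNat]
  let σ : ℕ → TraceClass X := fun n => (c n : ℂ) • ρ n
  have hσ : ∀ n, 0 ≤ (σ n : Op X) := by
    intro n
    rw [nonneg_iff_inner]
    intro f
    change 0 ≤ ⟪f, ((c n : ℂ) • (ρ n : Op X)) f⟫_ℂ
    rw [smul_apply, inner_smul_right]
    exact mul_nonneg (by exact_mod_cast (hc n).le) ((nonneg_iff_inner _).1 (hρ n) f)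
  have h2n : ∀ n : ℕ, (2 ^ n : ℝ≥0∞) ≠ 0 := fun n => by positivity
  have h2n' : ∀ n : ℕ, (2 ^ n : ℝ≥0∞) ≠ ∞ := fun n => by simp
  have htr : ∀ n, traceNorm (σ n : Op X) = (2⁻¹ : ℝ≥0∞) ^ n := by
    intro n
    change traceNorm ((c n : ℂ) • (ρ n : Op X)) = _
    rw [traceNorm_smul, hce, ENNReal.mul_inv (Or.inl (h2n n)) (Or.inl (h2n' n)), mul_assoc,
      ENNReal.inv_mul_cancel (hne n) (hfin n), mul_one, ENNReal.inv_pow]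
  have hbig : ∀ n : ℕ, (2 : ℝ≥0∞) ^ n ≤ traceNorm (L (σ n) : Op Y) := by
    intro n
    have h1 : L (σ n) = (c n : ℂ) • L (ρ n) := map_smul _ _ _
    rw [h1]
    change _ ≤ traceNorm ((c n : ℂ) • (L (ρ n) : Op Y))
    rw [traceNorm_smul, hce]
    calc (2 : ℝ≥0∞) ^ n = (2 ^ n * traceNorm (ρ n : Op X))⁻¹ *
          (4 ^ n * traceNorm (ρ n : Op X)) := by
          rw [show (4 : ℝ≥0∞) = 2 * 2 by norm_num, mul_pow, mul_assoc,
            mul_comm (2 ^ n : ℝ≥0∞) (2 ^ n * _), ← mul_assoc, ENNReal.inv_mul_cancel, one_mul]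
          · exact mul_ne_zero (h2n n) (hne n)
          · exact ENNReal.mul_ne_top (h2n' n) (hfin n)
      _ ≤ _ := by
          gcongr
          have := (hlt n).le
          simpa using this
  have hsumm : Summable fun n => (σ n : Op X) := by
    refine Summable.of_norm_bounded (g := fun n : ℕ => (2⁻¹ : ℝ) ^ n)
      (summable_geometric_of_lt_one (by norm_num) (by norm_num)) fun n => ?_
    have h1 := enorm_le_traceNorm (σ n : Op X)
    rw [htr] at h1
    have h2 := ENNReal.toReal_mono (by simp) h1
    simpa using h2
  have hτ : (∑' n, (σ n : Op X)) ∈ TraceClass X := by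
    refine (traceNorm_le_tsum hsumm.hasSum).trans_lt ?_
    simp_rw [htr]
    rw [ENNReal.tsum_geometric]
    simp
  let τ : TraceClass X := ⟨_, hτ⟩
  -- All summands are positive, so `σ n ≤ τ`. Positivity of `L` gives `L (σ n) ≤ L τ`, and the trace
  -- norm of `L τ` would exceed every `2ⁿ`.
  have hle : ∀ n, 0 ≤ ((τ - σ n : TraceClass X) : Op X) := by
    intro n
    rw [nonneg_iff_inner]
    intro f
    have h2 := (hsumm.hasSum.mapL (ContinuousLinearMap.apply ℂ (Ell2 X) f)).mapL (innerSL ℂ f)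
    simp only [ContinuousLinearMap.apply_apply, innerSL_apply_apply] at h2
    change 0 ≤ ⟪f, (((τ : Op X) - (σ n : Op X)) f)⟫_ℂ
    rw [sub_apply, inner_sub_right, sub_nonneg]
    exact le_hasSum h2 n fun m _ => (nonneg_iff_inner _).1 (hσ m) f
  have hbound : ∀ n : ℕ, (2 : ℝ≥0∞) ^ n ≤ traceNorm (L τ : Op Y) := by
    intro n
    refine (hbig n).trans (traceNorm_mono (hL _ (hσ n)) ?_)
    have := hL _ (hle n)
    rw [map_sub] at this
    exact sub_nonneg.1 this
  have hT : traceNorm (L τ : Op Y) ≠ ∞ := (L τ).2.ne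
  obtain ⟨n, hn⟩ := ENNReal.exists_nat_gt hT
  have h5 : (n : ℝ≥0∞) ≤ 2 ^ n := by exact_mod_cast Nat.lt_two_pow_self.le
  exact absurd (hbound n) (not_le.2 (hn.trans_le h5))

end TraceNorm

/-! ### Completely positive maps between different trace-class spaces. -/

section CP

variable {X : Type u} {Y : Type v} {Z : Type w}

/-- Complete positivity of a linear map between spaces of trace-class operators. -/
def IsCP (L : TraceClass X →ₗ[ℂ] TraceClass Y) : Prop :=
  ∀ (n : ℕ) (ρ : Fin n → Fin n → TraceClass X),
    BlockPositive (fun i j => (ρ i j : Op X)) → BlockPositive (fun i j => (L (ρ i j) : Op Y))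

/-- Reindexing frees complete positivity from `Fin n`; the index sets needed below are products with
a finite set of values of the second tensor factor. -/
theorem IsCP.map_family {L : TraceClass X →ₗ[ℂ] TraceClass Y} (hL : IsCP L) {ι : Type*} [Fintype ι]
    {ρ : ι → ι → TraceClass X}
    (h : ∀ ψ : ι → Ell2 X, 0 ≤ ∑ i, ∑ j, ⟪ψ i, (ρ i j : Op X) (ψ j)⟫_ℂ) (ψ : ι → Ell2 Y) :
    0 ≤ ∑ i, ∑ j, ⟪ψ i, (L (ρ i j) : Op Y) (ψ j)⟫_ℂ := by
  let e := Fintype.equivFin ι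
  have h1 := hL _ (fun i j => ρ (e.symm i) (e.symm j)) (fun φ => by
    have h2 := h (φ ∘ e)
    rw [← e.symm.sum_comp] at h2
    simp_rw [← e.symm.sum_comp (fun j => ⟪_, (ρ _ j : Op X) _⟫_ℂ)] at h2
    simpa using h2) (ψ ∘ e.symm)
  rw [← e.symm.sum_comp]
  simp_rw [← e.symm.sum_comp (fun j => ⟪_, (L (ρ _ j) : Op Y) _⟫_ℂ)]
  simpa using h1

theorem IsCP.nonneg {L : TraceClass X →ₗ[ℂ] TraceClass Y} (hL : IsCP L) {ρ : TraceClass X}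
    (hρ : 0 ≤ (ρ : Op X)) : 0 ≤ (L ρ : Op Y) := by
  rw [nonneg_iff_inner] at hρ ⊢
  intro f
  have := hL.map_family (ι := Unit) (ρ := fun _ _ => ρ) (fun ψ => by simpa using hρ (ψ ()))
    (fun _ => f)
  simpa using this

theorem IsCP.comp {L : TraceClass Y →ₗ[ℂ] TraceClass Z} {K : TraceClass X →ₗ[ℂ] TraceClass Y}
    (hL : IsCP L) (hK : IsCP K) : IsCP (L ∘ₗ K) := fun n _ h => hL n _ (hK n _ h)

theorem IsCP.sum {ι : Type*} {L : ι → TraceClass X →ₗ[ℂ] TraceClass Y} (F : Finset ι)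
    (hL : ∀ i ∈ F, IsCP (L i)) : IsCP (∑ i ∈ F, L i) := by
  classical
  induction F using Finset.induction_on with
  | empty => intro n ρ _ ψ; simp
  | insert k F hk ih =>
    intro n ρ h ψ
    have h1 := hL k (Finset.mem_insert_self _ _) n ρ h ψ
    have h2 := ih (fun i hi => hL i (Finset.mem_insert_of_mem hi)) n ρ h ψ
    rw [Finset.sum_insert hk]
    simp only [LinearMap.add_apply, Submodule.coe_add, add_apply, inner_add_right,
      Finset.sum_add_distrib]
    exact add_nonneg h1 h2

/-- A completely positive map is automatically a superoperator. -/
def IsCP.toSuperoperator {L : TraceClass X →ₗ[ℂ] TraceClass X} (hL : IsCP L) : Superoperator X where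
  toLinearMap := L
  completelyPositive := hL
  traceBounded := by
    obtain ⟨B, hB⟩ := exists_traceNorm_map_le L fun ρ hρ => hL.nonneg hρ
    refine ⟨B, fun ρ hρ => ?_⟩
    rw [← ContinuousLinearMap.nonneg_iff_isPositive] at hρ
    rw [trace_re_of_nonneg hρ, trace_re_of_nonneg (hL.nonneg hρ)]
    have h := ENNReal.toReal_mono (ENNReal.mul_ne_top ENNReal.coe_ne_top ρ.2.ne) (hB ρ hρ)
    simpa using h

theorem Superoperator.isCP (E : Superoperator X) : IsCP E.toLinearMap := E.completelyPositive

/-- `sandwich` as a linear map. -/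
def sandwichL (K L : Ell2 Y →L[ℂ] Ell2 X) (hK : ‖K‖ ≤ 1) (hL : ‖L‖ ≤ 1) :
    TraceClass X →ₗ[ℂ] TraceClass Y where
  toFun := sandwich K L hK hL
  map_add' ρ σ := Subtype.ext (by ext1 f; simp [sandwich])
  map_smul' c ρ := Subtype.ext (by ext1 f; simp [sandwich])

theorem isCP_sandwichL (K : Ell2 Y →L[ℂ] Ell2 X) (hK : ‖K‖ ≤ 1) : IsCP (sandwichL K K hK hK) := by
  intro n ρ h ψ
  have h1 := h fun i => K (ψ i)
  simpa [sandwichL, sandwich, ContinuousLinearMap.adjoint_inner_right] using h1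

theorem traceNorm_sandwichL_le (K L : Ell2 Y →L[ℂ] Ell2 X) (hK : ‖K‖ ≤ 1) (hL : ‖L‖ ≤ 1)
    (ρ : TraceClass X) : traceNorm (sandwichL K L hK hL ρ : Op Y) ≤ traceNorm (ρ : Op X) :=
  traceNorm_conj_le _ K L hK hL

/-- `block` as a linear map. -/
def blockL (y y' : Y) : TraceClass (X × Y) →ₗ[ℂ] TraceClass X :=
  sandwichL (tensorKet y) (tensorKet y') (tensorKet_norm_le y) (tensorKet_norm_le y')

theorem isCP_blockL (y : Y) : IsCP (blockL (X := X) y y) := isCP_sandwichL _ _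

end CP

/-! ### Block decomposition of operators on a tensor product. -/

section Blocks

variable {X : Type u} {Y : Type v}

theorem tensorKet_adjoint_self (y : Y) (f : Ell2 X) :
    ContinuousLinearMap.adjoint (tensorKet y) (tensorKet y f) = f := by
  have h : (tensorKet y : Ell2 X →L[ℂ] Ell2 (X × Y)) =
    (basisIsometry (fun x => (x, y)) (Prod.mk_left_injective y)).toContinuousLinearMap := rfl
  refine ext_inner_left ℂ fun g => ?_
  rw [ContinuousLinearMap.adjoint_inner_right, h]
  exact (basisIsometry (fun x => (x, y)) (Prod.mk_left_injective y)).inner_map_map g f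

theorem hasSum_ket (f : Ell2 X) : HasSum (fun x => ⟪ket x, f⟫_ℂ • ket x) f := by
  have := (ketBasis X).hasSum_repr f
  simp only [HilbertBasis.repr_apply_apply] at this
  exact this

theorem ext_ket {A B : Ell2 X →L[ℂ] Ell2 Y} (h : ∀ x, A (ket x) = B (ket x)) : A = B := by
  refine ContinuousLinearMap.ext_on (s := Set.range (ket : X → _)) ?_ ?_
  · rw [← Submodule.dense_iff_topologicalClosure_eq_top.symm.eq]
    exact (ketBasis X).dense_span
  · rintro _ ⟨q, rfl⟩
    exact h q

theorem ext_inner_ket {f g : Ell2 X} (h : ∀ x, ⟪ket x, f⟫_ℂ = ⟪ket x, g⟫_ℂ) : f = g := by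
  have h1 := hasSum_ket f
  simp_rw [h] at h1
  exact h1.unique (hasSum_ket g)

theorem tensorKet_adjoint_of_ne {y y' : Y} (h : y ≠ y') :
    ContinuousLinearMap.adjoint (tensorKet y) ∘L (tensorKet y' : Ell2 X →L[ℂ] Ell2 (X × Y)) =
      0 := by
  refine ext_ket fun x => ext_inner_ket fun x' => ?_
  rw [ContinuousLinearMap.comp_apply, ContinuousLinearMap.adjoint_inner_right, tensorKet, tensorKet,
    basisOp_ket, basisOp_ket, ket_orthonormal.inner_eq_zero (by simp [h])]
  simp

open Classical in
theorem tensorKet_adjoint_comp (y y' : Y) :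
    ContinuousLinearMap.adjoint (tensorKet y) ∘L (tensorKet y' : Ell2 X →L[ℂ] Ell2 (X × Y)) =
      if y = y' then 1 else 0 := by
  split_ifs with h
  · subst h
    ext1 f
    exact tensorKet_adjoint_self y f
  · exact tensorKet_adjoint_of_ne h

theorem hasSum_tensorKet (f : Ell2 (X × Y)) :
    HasSum (fun y : Y => tensorKet y (ContinuousLinearMap.adjoint (tensorKet y) f)) f := by
  have h1 := (Equiv.prodComm Y X).hasSum_iff.2 (hasSum_ket f)
  refine h1.prod_fiberwise fun y => ?_
  have h2 := (hasSum_ket (ContinuousLinearMap.adjoint (tensorKet y) f)).mapL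
    (tensorKet y : Ell2 X →L[ℂ] Ell2 (X × Y))
  simpa only [map_smul, ContinuousLinearMap.adjoint_inner_right, tensorKet, basisOp_ket,
    Function.comp_def, Equiv.prodComm_apply, Prod.swap_prod_mk] using h2

/-- The trace norm of a positive operator is the sum of those of its diagonal blocks. -/
theorem traceNorm_eq_tsum_block {A : Op (X × Y)} (hA : 0 ≤ A) :
    traceNorm A =
      ∑' y : Y, traceNorm (ContinuousLinearMap.adjoint (tensorKet y) ∘L A ∘L tensorKet y) := by
  have h1 : ∀ y : Y,
      0 ≤ (ContinuousLinearMap.adjoint (tensorKet y) ∘L A ∘L tensorKet y : Op X) := by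
    intro y
    rw [nonneg_iff_inner] at hA ⊢
    intro f
    rw [ContinuousLinearMap.comp_apply, ContinuousLinearMap.adjoint_inner_right]
    exact hA _
  simp_rw [fun y => traceNorm_of_nonneg (h1 y)]
  rw [traceNorm_of_nonneg hA, ENNReal.tsum_prod', ENNReal.tsum_comm]
  simp only [ContinuousLinearMap.comp_apply, ContinuousLinearMap.adjoint_inner_right, tensorKet,
    basisOp_ket]

/-- The operator with the given blocks, indexed by a finite set. -/
def ofBlocks (a : Y → Y → Op X) (F : Finset Y) : Op (X × Y) :=
  ∑ y ∈ F, ∑ y' ∈ F, tensorKet y ∘L a y y' ∘L ContinuousLinearMap.adjoint (tensorKet y')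

theorem inner_ofBlocks (a : Y → Y → Op X) (F : Finset Y) (f g : Ell2 (X × Y)) :
    ⟪f, ofBlocks a F g⟫_ℂ = ∑ y : F, ∑ y' : F,
      ⟪ContinuousLinearMap.adjoint (tensorKet (y : Y)) f,
        a y y' (ContinuousLinearMap.adjoint (tensorKet (y' : Y)) g)⟫_ℂ := by
  simp only [ofBlocks, sum_apply, inner_sum, ContinuousLinearMap.comp_apply,
    ContinuousLinearMap.adjoint_inner_left]
  rw [← Finset.sum_coe_sort F]
  refine Finset.sum_congr rfl fun y _ => ?_
  rw [← Finset.sum_coe_sort F]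

/-- Stated for a general `R` because it is applied both to the coordinate projection `blockProj F`
and to its complement. -/
theorem conj_ofBlocks (a : Y → Y → Op X) (F : Finset Y) (p : Y → Prop) [DecidablePred p]
    {R : Op (X × Y)} (hR : ∀ y, R ∘L tensorKet y = if p y then tensorKet y else 0) :
    R ∘L ofBlocks a F ∘L ContinuousLinearMap.adjoint R = ofBlocks a (F.filter p) := by
  have h : ∀ y y' : Y, R ∘L (tensorKet y ∘L a y y' ∘L ContinuousLinearMap.adjoint (tensorKet y')) ∘L
      ContinuousLinearMap.adjoint R = if p y then (if p y' then
        tensorKet y ∘L a y y' ∘L ContinuousLinearMap.adjoint (tensorKet y') else 0) else 0 := by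
    intro y y'
    rw [show R ∘L (tensorKet y ∘L a y y' ∘L ContinuousLinearMap.adjoint (tensorKet y')) ∘L
      ContinuousLinearMap.adjoint R = (R ∘L tensorKet y) ∘L a y y' ∘L
        ContinuousLinearMap.adjoint (R ∘L tensorKet y') by
      rw [ContinuousLinearMap.adjoint_comp]; rfl, hR, hR]
    split_ifs <;> simp
  simp only [ofBlocks, ContinuousLinearMap.comp_finsetSum, ContinuousLinearMap.finsetSum_comp, h]
  rw [Finset.sum_filter]
  refine Finset.sum_congr rfl fun y _ => ?_
  split_ifs
  · rw [Finset.sum_filter]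
  · simp

open Classical in
theorem block_ofBlocks (a : Y → Y → Op X) (F : Finset Y) (y y' : Y) :
    ContinuousLinearMap.adjoint (tensorKet y) ∘L ofBlocks a F ∘L tensorKet y' =
      if y ∈ F ∧ y' ∈ F then a y y' else 0 := by
  have h : ∀ z z' : Y, ContinuousLinearMap.adjoint (tensorKet y) ∘L
      (tensorKet z ∘L a z z' ∘L ContinuousLinearMap.adjoint (tensorKet z')) ∘L
      tensorKet y' = if y = z then (if z' = y' then a z z' else 0) else 0 := by
    intro z z'
    rw [show ContinuousLinearMap.adjoint (tensorKet y) ∘L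
      (tensorKet z ∘L a z z' ∘L ContinuousLinearMap.adjoint (tensorKet z')) ∘L
      tensorKet y' = (ContinuousLinearMap.adjoint (tensorKet y) ∘L tensorKet z) ∘L a z z' ∘L
        (ContinuousLinearMap.adjoint (tensorKet z') ∘L tensorKet y') from rfl,
      tensorKet_adjoint_comp, tensorKet_adjoint_comp]
    split_ifs <;> simp [ContinuousLinearMap.one_def]
  simp only [ofBlocks, ContinuousLinearMap.comp_finsetSum, ContinuousLinearMap.finsetSum_comp, h]
  by_cases hy : y ∈ F <;> by_cases hy' : y' ∈ F <;> simp [hy, hy']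

end Blocks

/-! ### A norm estimate for compressing a positive element. -/

section Compression

variable {𝔄 : Type u} [CStarAlgebra 𝔄] [PartialOrder 𝔄] [StarOrderedRing 𝔄]

/-- With `s = √a`, the difference is `(1 - q) s s + q s s (1 - q)`. Both terms are controlled by
`‖(1 - q) s‖ ‖s‖`, and `‖(1 - q) s‖² = ‖(1 - q) a (1 - q)‖`. Thus the off-diagonal corners of a
positive element are small once one diagonal corner is. -/
theorem norm_sub_compression_le {a q : 𝔄} (ha : 0 ≤ a) (hq : IsStarProjection q) :
    ‖a - q * a * star q‖ ≤ 2 * (√‖(1 - q) * a * star (1 - q)‖ * √‖a‖) := by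
  set s := CFC.sqrt a
  have hs : s * s = a := CFC.sqrt_mul_sqrt_self a ha
  have hsa : star s = s := (CFC.sqrt_nonneg a).isSelfAdjoint
  have hqs : star q = q := hq.isSelfAdjoint
  have h1 : ‖(1 - q) * s‖ = √‖(1 - q) * a * star (1 - q)‖ := by
    rw [show (1 - q) * a * star (1 - q) = ((1 - q) * s) * star ((1 - q) * s) by
      rw [star_mul, hsa, ← hs]; simp only [mul_assoc], CStarRing.norm_self_mul_star,
      Real.sqrt_mul_self (norm_nonneg _)]
  have h2 : ‖s‖ = √‖a‖ := by
    have : ‖a‖ = ‖s‖ * ‖s‖ := by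
      rw [← hs, ← CStarRing.norm_star_mul_self, hsa]
    rw [this, Real.sqrt_mul_self (norm_nonneg _)]
  have h3 : ‖s * (1 - q)‖ = ‖(1 - q) * s‖ := by
    rw [← norm_star (s * (1 - q)), star_mul, hsa, star_sub, star_one, hqs]
  have h4 : a - q * a * star q = (1 - q) * s * s + q * (s * (s * (1 - q))) := by
    rw [hqs, ← hs]
    noncomm_ring
  have h5 : ‖q‖ ≤ 1 := hq.norm_le
  rw [h4, ← h1, ← h2]
  have h6 : ‖(1 - q) * s * s‖ ≤ ‖(1 - q) * s‖ * ‖s‖ := norm_mul_le _ _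
  have h7 : ‖q * (s * (s * (1 - q)))‖ ≤ ‖(1 - q) * s‖ * ‖s‖ :=
    calc _ ≤ ‖q‖ * (‖s‖ * ‖s * (1 - q)‖) :=
          (norm_mul_le _ _).trans (mul_le_mul_of_nonneg_left (norm_mul_le _ _) (norm_nonneg _))
      _ ≤ 1 * (‖s‖ * ‖s * (1 - q)‖) := by gcongr
      _ = _ := by rw [h3]; ring
  linarith [norm_add_le ((1 - q) * s * s) (q * (s * (s * (1 - q))))]

end Compression

/-! ### Existence and complete positivity of `E ⊗ id`. -/

section TensorId

variable {X : Type u} {Y : Type v}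

/-- The projection onto the coordinates in a finite set `F` of the second factor. -/
def blockProj (F : Finset Y) : Op (X × Y) :=
  ∑ y ∈ F, tensorKet y ∘L ContinuousLinearMap.adjoint (tensorKet y)

open Classical in
theorem blockProj_comp_tensorKet (F : Finset Y) (y : Y) :
    (blockProj F : Op (X × Y)) ∘L tensorKet y = if y ∈ F then tensorKet y else 0 := by
  simp only [blockProj, ContinuousLinearMap.finsetSum_comp, ContinuousLinearMap.comp_assoc,
    tensorKet_adjoint_comp]
  have : ∀ z : Y, (tensorKet z ∘L (if z = y then (1 : Op X) else 0) : Ell2 X →L[ℂ] Ell2 (X × Y)) =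
      if z = y then tensorKet z else 0 := by
    intro z
    split_ifs <;> simp [ContinuousLinearMap.one_def]
  simp [this]

theorem isStarProjection_blockProj (F : Finset Y) :
    IsStarProjection (blockProj F : Op (X × Y)) where
  isIdempotentElem := by
    classical
    change (blockProj F : Op (X × Y)) ∘L blockProj F = blockProj F
    conv_lhs => enter [2]; rw [blockProj]
    rw [ContinuousLinearMap.comp_finsetSum, blockProj]
    refine Finset.sum_congr rfl fun y hy => ?_
    rw [← ContinuousLinearMap.comp_assoc, ← blockProj, blockProj_comp_tensorKet, if_pos hy]
  isSelfAdjoint := by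
    change star _ = _
    rw [blockProj, star_sum]
    refine Finset.sum_congr rfl fun y _ => ?_
    rw [ContinuousLinearMap.star_eq_adjoint, ContinuousLinearMap.adjoint_comp,
      ContinuousLinearMap.adjoint_adjoint]

open Classical in
theorem norm_ofBlocks_sub_le (a : Y → Y → Op X) {F G : Finset Y} (hFG : F ⊆ G)
    (hG : 0 ≤ ofBlocks a G) :
    ‖ofBlocks a G - ofBlocks a F‖ ≤ 2 * (√‖ofBlocks a (G \ F)‖ * √‖ofBlocks a G‖) := by
  have h := norm_sub_compression_le hG (isStarProjection_blockProj F)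
  have h1 : blockProj F * ofBlocks a G * star (blockProj F) = ofBlocks a F := by
    have := conj_ofBlocks a G (· ∈ F) (blockProj_comp_tensorKet F)
    rw [Finset.filter_mem_eq_inter, Finset.inter_eq_right.2 hFG] at this
    rw [← this]
    rfl
  have h2 : (1 - blockProj F) * ofBlocks a G * star (1 - blockProj F) = ofBlocks a (G \ F) := by
    have := conj_ofBlocks a G (· ∉ F) (R := 1 - blockProj F) (fun y => by
      rw [ContinuousLinearMap.sub_comp, blockProj_comp_tensorKet]
      split_ifs <;> simp_all [ContinuousLinearMap.one_def])
    rw [Finset.filter_notMem_eq_sdiff] at this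
    rw [← this]
    rfl
  rwa [h1, h2] at h

/-- A family of operators whose finite sections are positive and whose diagonal has summable trace
norms consists of the blocks of a bounded operator. -/
theorem exists_of_blocks (a : Y → Y → Op X) (ha : ∀ F, 0 ≤ ofBlocks a F)
    (hs : ∑' y, traceNorm (a y y) ≠ ∞) :
    ∃ A : Op (X × Y), 0 ≤ A ∧
      ∀ y y', ContinuousLinearMap.adjoint (tensorKet y) ∘L A ∘L tensorKet y' = a y y' := by
  classical
  set t : Y → ℝ := fun y => (traceNorm (a y y)).toReal with ht
  have hfin : ∀ y, traceNorm (a y y) ≠ ∞ := fun y => ENNReal.ne_top_of_tsum_ne_top hs y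
  have htsum : Summable t := ENNReal.summable_toReal hs
  have ht0 : ∀ y, 0 ≤ t y := fun y => ENNReal.toReal_nonneg
  -- The operator norm is at most the trace norm, which for a positive section is the sum over the
  -- diagonal.
  have hnorm : ∀ F, ‖ofBlocks a F‖ ≤ ∑ y ∈ F, t y := by
    intro F
    have h1 := enorm_le_traceNorm (ofBlocks a F)
    rw [traceNorm_eq_tsum_block (ha F)] at h1
    simp_rw [block_ofBlocks, and_self] at h1
    rw [tsum_eq_sum (s := F) (fun y hy => by rw [if_neg hy, traceNorm_zero])] at h1
    rw [Finset.sum_congr rfl (fun y hy => by rw [if_pos hy])] at h1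
    have h2 := ENNReal.toReal_mono (ENNReal.sum_ne_top.2 fun y _ => hfin y) h1
    rw [ENNReal.toReal_sum fun y _ => hfin y] at h2
    simpa using h2
  set C : ℝ := ∑' y, t y
  have hcauchy : CauchySeq (ofBlocks a) := by
    -- This form of the Cauchy criterion compares only `G ⊇ N` with `N`, the nested case of
    -- `norm_ofBlocks_sub_le`: the section over `G \ N` is small as a tail of the diagonal.
    rw [Metric.cauchySeq_iff']
    intro ε hε
    -- The `+ 1` keeps the denominator positive and the final inequality strict when `C = 0`.
    set η : ℝ := ε / (2 * (√C + 1)) with hη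
    have hC1 : 0 < √C + 1 := by positivity
    have hη0 : 0 < η := by positivity
    obtain ⟨N, hN⟩ := summable_iff_vanishing_norm.1 htsum (η ^ 2) (by positivity)
    refine ⟨N, fun G hG => ?_⟩
    have h1 := norm_ofBlocks_sub_le a hG (ha G)
    have h2 : √‖ofBlocks a (G \ N)‖ < η := by
      rw [Real.sqrt_lt' hη0]
      refine (hnorm _).trans_lt (lt_of_le_of_lt (le_abs_self _) ?_)
      exact hN _ Finset.sdiff_disjoint
    have h3 : √‖ofBlocks a G‖ ≤ √C :=
      Real.sqrt_le_sqrt ((hnorm G).trans (htsum.sum_le_tsum _ fun y _ => ht0 y))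
    rw [dist_eq_norm]
    calc _ ≤ 2 * (√‖ofBlocks a (G \ N)‖ * √‖ofBlocks a G‖) := h1
      _ ≤ 2 * (η * √C) := by gcongr
      _ < 2 * (η * (√C + 1)) := by gcongr; linarith
      _ = ε := by rw [hη]; field_simp
  obtain ⟨A, hA⟩ := cauchySeq_tendsto_of_complete hcauchy
  refine ⟨A, ge_of_tendsto' hA ha, fun y y' => ?_⟩
  have h1 : Tendsto (fun F => ContinuousLinearMap.adjoint (tensorKet y) ∘L ofBlocks a F ∘L
      tensorKet y') atTop (𝓝 (ContinuousLinearMap.adjoint (tensorKet y) ∘L A ∘L tensorKet y')) :=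
    (((continuous_const.clm_comp (continuous_id.clm_comp continuous_const))).tendsto A).comp hA
  refine tendsto_nhds_unique h1 (tendsto_const_nhds.congr' ?_)
  filter_upwards [eventually_ge_atTop {y, y'}] with F hF
  rw [block_ofBlocks, if_pos ⟨hF (by simp), hF (by simp)⟩]

/-- A vector family over `ι × F` in `ℓ²(X)` is the same as a family over `ι` in `ℓ²(X × Y)`
supported on `F`. This moves positivity between a matrix of operators and the larger matrix of their
blocks, in both directions. -/
theorem sum_inner_block {ι : Type*} [Fintype ι] (ρ : ι → ι → TraceClass (X × Y)) (F : Finset Y)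
    (ψ : ι × F → Ell2 X) :
    ∑ p : ι × F, ∑ q : ι × F,
        ⟪ψ p, (block (p.2 : Y) (q.2 : Y) (ρ p.1 q.1) : Op X) (ψ q)⟫_ℂ =
      ∑ i, ∑ j, ⟪∑ y : F, tensorKet (y : Y) (ψ (i, y)),
        (ρ i j : Op (X × Y)) (∑ y : F, tensorKet (y : Y) (ψ (j, y)))⟫_ℂ := by
  simp only [map_sum, sum_inner, inner_sum, Fintype.sum_prod_type, block, sandwich,
    ContinuousLinearMap.comp_apply, ContinuousLinearMap.adjoint_inner_right]
  refine Finset.sum_congr rfl fun i _ => ?_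
  rw [Finset.sum_comm]
  refine Finset.sum_congr rfl fun j _ => ?_
  rw [Finset.sum_comm]

theorem block_family_nonneg {ι : Type*} [Fintype ι] {ρ : ι → ι → TraceClass (X × Y)}
    (h : ∀ ψ : ι → Ell2 (X × Y), 0 ≤ ∑ i, ∑ j, ⟪ψ i, (ρ i j : Op (X × Y)) (ψ j)⟫_ℂ)
    (F : Finset Y) (ψ : ι × F → Ell2 X) :
    0 ≤ ∑ p : ι × F, ∑ q : ι × F,
      ⟪ψ p, (block (p.2 : Y) (q.2 : Y) (ρ p.1 q.1) : Op X) (ψ q)⟫_ℂ := by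
  rw [sum_inner_block]
  exact h _

/-- For `ρ ≥ 0`, complete positivity makes every finite section of the matrix `E(ρ_yy')` positive,
and the bound for `E` on positive operators makes its diagonal summable in trace norm. So
`exists_of_blocks` yields a positive operator, which is trace class because its trace norm is the
diagonal sum. The general case follows by linearity. -/
theorem exists_tensorId {E : TraceClass X →ₗ[ℂ] TraceClass X} (hE : IsCP E)
    (ρ : TraceClass (X × Y)) :
    ∃ σ : TraceClass (X × Y), ∀ y y', block y y' σ = E (block y y' ρ) := by
  induction ρ using TraceClass.induction_nonneg with
  | pos ρ hρ =>
    let a : Y → Y → Op X := fun y y' => E (block y y' ρ)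
    have ha : ∀ F, 0 ≤ ofBlocks a F := by
      intro F
      rw [nonneg_iff_inner]
      intro f
      rw [inner_ofBlocks]
      have h1 := block_family_nonneg (ι := Unit) (ρ := fun _ _ => ρ)
        (fun ψ => by simpa using (nonneg_iff_inner _).1 hρ (ψ ())) F
      have h2 := hE.map_family (ρ := fun p q : Unit × F => block (p.2 : Y) (q.2 : Y) ρ) h1
        (fun p => ContinuousLinearMap.adjoint (tensorKet (p.2 : Y)) f)
      simpa [Fintype.sum_prod_type] using h2
    obtain ⟨B, hB⟩ := exists_traceNorm_map_le E fun ρ hρ => hE.nonneg hρ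
    have htn : ∑' y, traceNorm (a y y) ≤ B * traceNorm (ρ : Op (X × Y)) := by
      rw [traceNorm_eq_tsum_block hρ, ← ENNReal.tsum_mul_left]
      exact ENNReal.tsum_le_tsum fun y => hB _ ((isCP_blockL y).nonneg hρ)
    have hs : ∑' y, traceNorm (a y y) < ∞ :=
      htn.trans_lt (ENNReal.mul_lt_top ENNReal.coe_lt_top ρ.2)
    obtain ⟨A, hA, hblock⟩ := exists_of_blocks a ha hs.ne
    refine ⟨⟨A, ?_⟩, fun y y' => Subtype.ext (hblock y y')⟩
    change traceNorm A < ∞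
    rw [traceNorm_eq_tsum_block hA]
    simpa only [hblock] using hs
  | add ρ σ h1 h2 =>
    obtain ⟨ρ', h1⟩ := h1
    obtain ⟨σ', h2⟩ := h2
    refine ⟨ρ' + σ', fun y y' => ?_⟩
    have e1 : block y y' (ρ' + σ') = block y y' ρ' + block y y' σ' := map_add (blockL y y') _ _
    have e2 : block y y' (ρ + σ) = block y y' ρ + block y y' σ := map_add (blockL y y') _ _
    rw [e1, e2, map_add, h1, h2]
  | smul c ρ h =>
    obtain ⟨ρ', h⟩ := h
    refine ⟨c • ρ', fun y y' => ?_⟩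
    have e1 : block y y' (c • ρ') = c • block y y' ρ' := map_smul (blockL y y') _ _
    have e2 : block y y' (c • ρ) = c • block y y' ρ := map_smul (blockL y y') _ _
    rw [e1, e2, map_smul, h]

theorem block_tensorId {E : TraceClass X →ₗ[ℂ] TraceClass X} (hE : IsCP E)
    (ρ : TraceClass (X × Y)) (y y' : Y) : block y y' (tensorId E ρ) = E (block y y' ρ) := by
  obtain ⟨σ, h⟩ := exists_tensorId hE ρ
  rw [tensorId_eq h, h]

/-- `E ⊗ id` as a linear map. -/
def tensorIdL {E : TraceClass X →ₗ[ℂ] TraceClass X} (hE : IsCP E) :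
    TraceClass (X × Y) →ₗ[ℂ] TraceClass (X × Y) where
  toFun := tensorId E
  map_add' ρ σ := tensorId_eq fun y y' => by
    have e1 := map_add (blockL y y') (tensorId E ρ) (tensorId E σ)
    have e2 := map_add (blockL y y') ρ σ
    change block y y' _ = block y y' _ + block y y' _ at e1 e2
    rw [e1, e2, map_add, block_tensorId hE, block_tensorId hE]
  map_smul' c ρ := tensorId_eq fun y y' => by
    have e1 := map_smul (blockL y y') c (tensorId E ρ)
    have e2 := map_smul (blockL y y') c ρ
    change block y y' _ = c • block y y' _ at e1 e2
    rw [RingHom.id_apply, e1, e2, map_smul, block_tensorId hE]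

/-- Truncating the test vectors to finitely many values `F` of the second factor turns the claim
into positivity of `E` on matrices indexed by `Fin n × F`; the truncations converge in norm and the
quadratic form is continuous. -/
theorem isCP_tensorIdL {E : TraceClass X →ₗ[ℂ] TraceClass X} (hE : IsCP E) :
    IsCP (tensorIdL (Y := Y) hE) := by
  intro n ρ h ψ
  let Q : Finset Y → Fin n → Ell2 (X × Y) := fun F i =>
    ∑ y ∈ F, tensorKet y (ContinuousLinearMap.adjoint (tensorKet y) (ψ i))
  have hQ : ∀ i, Tendsto (fun F => Q F i) atTop (𝓝 (ψ i)) := fun i => hasSum_tensorKet (ψ i)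
  have hlim : Tendsto (fun F => ∑ i, ∑ j, ⟪Q F i, (tensorId E (ρ i j) : Op (X × Y)) (Q F j)⟫_ℂ)
      atTop (𝓝 (∑ i, ∑ j, ⟪ψ i, (tensorId E (ρ i j) : Op (X × Y)) (ψ j)⟫_ℂ)) :=
    tendsto_finsetSum _ fun i _ => tendsto_finsetSum _ fun j _ =>
      (hQ i).inner (((tensorId E (ρ i j) : Op (X × Y)).continuous.tendsto _).comp (hQ j))
  refine ge_of_tendsto' hlim fun F => ?_
  have h1 := block_family_nonneg h F
  have h2 := hE.map_family
    (ρ := fun p q : Fin n × F => block (p.2 : Y) (q.2 : Y) (ρ p.1 q.1)) h1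
    (fun p => ContinuousLinearMap.adjoint (tensorKet (p.2 : Y)) (ψ p.1))
  refine h2.trans_eq ?_
  simp only [← block_tensorId hE]
  rw [sum_inner_block (fun i j => tensorId E (ρ i j)) F]
  have h3 : ∀ i, ∑ y : F, tensorKet (y : Y)
      (ContinuousLinearMap.adjoint (tensorKet (y : Y)) (ψ i)) = Q F i := fun i =>
    Finset.sum_coe_sort F fun y => tensorKet y (ContinuousLinearMap.adjoint (tensorKet y) (ψ i))
  simp only [h3]

end TensorId

/-! ### Linearity and complete positivity of the partial trace. -/

section PartialTrace

variable {X : Type u} {Y : Type v}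

theorem inner_partialTrace (ρ : TraceClass (X × Y)) (f g : Ell2 X) :
    HasSum (fun y : Y => ⟪tensorKet y f, (ρ : Op (X × Y)) (tensorKet y g)⟫_ℂ)
      ⟪f, (partialTrace ρ : Op X) g⟫_ℂ := by
  have h := ((summable_partialTrace ρ).hasSum.mapL (ContinuousLinearMap.apply ℂ (Ell2 X) g)).mapL
    (innerSL ℂ f)
  simp only [ContinuousLinearMap.apply_apply, ContinuousLinearMap.comp_apply,
    innerSL_apply_apply, ContinuousLinearMap.adjoint_inner_right] at h
  exact h

/-- The partial trace as a linear map. -/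
def partialTraceL : TraceClass (X × Y) →ₗ[ℂ] TraceClass X where
  toFun := partialTrace
  map_add' ρ σ := Subtype.ext (by
    ext1 g
    refine ext_inner_left ℂ fun f => ?_
    have h := (inner_partialTrace ρ f g).add (inner_partialTrace σ f g)
    have h' := inner_partialTrace (ρ + σ) f g
    simp only [Submodule.coe_add, add_apply, inner_add_right] at h' ⊢
    exact h'.unique h)
  map_smul' c ρ := Subtype.ext (by
    ext1 g
    refine ext_inner_left ℂ fun f => ?_
    have h := (inner_partialTrace ρ f g).mul_left c
    have h' := inner_partialTrace (c • ρ) f g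
    simp only [Submodule.coe_smul, smul_apply, inner_smul_right, RingHom.id_apply] at h' ⊢
    exact h'.unique h)

theorem isCP_partialTraceL : IsCP (partialTraceL (X := X) (Y := Y)) := by
  intro n ρ h ψ
  have h1 := hasSum_sum (s := Finset.univ) fun i _ => hasSum_sum (s := Finset.univ) fun j _ =>
    inner_partialTrace (ρ i j) (ψ i) (ψ j)
  exact h1.nonneg fun y => h fun i => tensorKet y (ψ i)

end PartialTrace

/-! ### `LOCAL` of a completely positive map is completely positive. -/

section LocalVarL

variable {Var : Type u} {T : Var → Type v}

/-- `swapConj` as a linear map. -/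
def swapConjL (x : Var) : TraceClass (Mem T × T x) →ₗ[ℂ] TraceClass (Mem T × T x) :=
  sandwichL (ContinuousLinearMap.adjoint (basisOp (swapMem x) (swapMem_involutive x).injective))
    (ContinuousLinearMap.adjoint (basisOp (swapMem x) (swapMem_involutive x).injective))
    (by rw [LinearIsometryEquiv.norm_map]; exact basisOp_norm_le _ _)
    (by rw [LinearIsometryEquiv.norm_map]; exact basisOp_norm_le _ _)

/-- `tensorPure` as a linear map. -/
def tensorPureL {X : Type u} {Y : Type v} (y : Y) : TraceClass X →ₗ[ℂ] TraceClass (X × Y) :=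
  sandwichL (ContinuousLinearMap.adjoint (tensorKet y)) (ContinuousLinearMap.adjoint (tensorKet y))
    (by rw [LinearIsometryEquiv.norm_map]; exact tensorKet_norm_le y)
    (by rw [LinearIsometryEquiv.norm_map]; exact tensorKet_norm_le y)

/-- `localVar` applied to a completely positive map, as a linear map. -/
def localVarL (init : Mem T) (x : Var) {E : TraceClass (Mem T) →ₗ[ℂ] TraceClass (Mem T)}
    (hE : IsCP E) : TraceClass (Mem T) →ₗ[ℂ] TraceClass (Mem T) :=
  partialTraceL ∘ₗ swapConjL x ∘ₗ tensorIdL hE ∘ₗ swapConjL x ∘ₗ tensorPureL (init x)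

theorem isCP_localVarL (init : Mem T) (x : Var) {E : TraceClass (Mem T) →ₗ[ℂ] TraceClass (Mem T)}
    (hE : IsCP E) : IsCP (localVarL init x hE) :=
  isCP_partialTraceL.comp <| (isCP_sandwichL _ _).comp <| (isCP_tensorIdL hE).comp <|
    (isCP_sandwichL _ _).comp (isCP_sandwichL _ _)

end LocalVarL

/-! ### Trace-norm convergent series of completely positive maps. -/

section TraceSum

variable {X : Type u} {Y : Type v} {I : Type w}

theorem TraceSum.add {ρ ρ' : I → TraceClass X} {σ σ' : TraceClass X} (h : TraceSum ρ σ)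
    (h' : TraceSum ρ' σ') : TraceSum (fun i => ρ i + ρ' i) (σ + σ') := by
  have h1 := Tendsto.add h h'
  rw [add_zero] at h1
  refine tendsto_of_tendsto_of_tendsto_of_le_of_le tendsto_const_nhds h1 (fun _ => zero_le)
    fun F => ?_
  have h2 := traceNorm_add_le ((∑ i ∈ F, ρ i - σ : TraceClass X) : Op X)
    ((∑ i ∈ F, ρ' i - σ' : TraceClass X) : Op X)
  rw [← Submodule.coe_add] at h2
  have h3 : ∑ i ∈ F, ρ i - σ + (∑ i ∈ F, ρ' i - σ') = ∑ i ∈ F, (ρ i + ρ' i) - (σ + σ') := by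
    rw [Finset.sum_add_distrib]
    abel
  rwa [h3] at h2

theorem TraceSum.smul {ρ : I → TraceClass X} {σ : TraceClass X} (h : TraceSum ρ σ) (c : ℂ) :
    TraceSum (fun i => c • ρ i) (c • σ) := by
  have h1 := ENNReal.Tendsto.const_mul (a := ‖c‖ₑ) h (Or.inr enorm_ne_top)
  rw [mul_zero] at h1
  refine h1.congr fun F => ?_
  rw [← traceNorm_smul, ← Submodule.coe_smul, smul_sub, Finset.smul_sum]

theorem TraceSum.map {ρ : I → TraceClass X} {σ : TraceClass X} (h : TraceSum ρ σ)
    (L : TraceClass X →ₗ[ℂ] TraceClass Y)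
    (hL : ∀ ρ, traceNorm (L ρ : Op Y) ≤ traceNorm (ρ : Op X)) :
    TraceSum (fun i => L (ρ i)) (L σ) := by
  refine tendsto_of_tendsto_of_tendsto_of_le_of_le tendsto_const_nhds h (fun _ => zero_le)
    fun F => ?_
  have h1 := hL (∑ i ∈ F, ρ i - σ)
  rwa [map_sub, map_sum] at h1

/-- Convergence in operator norm is weaker, but it suffices for uniqueness of sums and for passing
to the limit in matrix coefficients. -/
theorem TraceSum.hasSum {ρ : I → TraceClass X} {σ : TraceClass X} (h : TraceSum ρ σ) :
    HasSum (fun i => (ρ i : Op X)) (σ : Op X) := by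
  change Tendsto (fun F : Finset I => ∑ i ∈ F, (ρ i : Op X)) atTop (𝓝 (σ : Op X))
  rw [tendsto_iff_edist_tendsto_0]
  refine tendsto_of_tendsto_of_tendsto_of_le_of_le tendsto_const_nhds h (fun _ => zero_le)
    fun F => ?_
  rw [edist_eq_enorm_sub]
  have := enorm_le_traceNorm ((∑ i ∈ F, ρ i - σ : TraceClass X) : Op X)
  simpa using this

theorem TraceSum.unique {ρ : I → TraceClass X} {σ τ : TraceClass X} (h : TraceSum ρ σ)
    (h' : TraceSum ρ τ) : σ = τ := Subtype.ext (h.hasSum.unique h'.hasSum)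

/-- A pointwise convergent series of linear maps has a linear sum. -/
def sumLinearMap (L : I → TraceClass X →ₗ[ℂ] TraceClass X) {S : TraceClass X → TraceClass X}
    (h : SumsTo (fun i => ⇑(L i)) S) : TraceClass X →ₗ[ℂ] TraceClass X where
  toFun := S
  map_add' ρ σ := (h (ρ + σ)).unique (by simpa only [map_add] using (h ρ).add (h σ))
  map_smul' c ρ := (h (c • ρ)).unique (by
    simpa only [map_smul, RingHom.id_apply] using (h ρ).smul c)

/-- The remainders of a convergent series of completely positive maps are completely positive. -/
theorem isCP_sub_sum {L : I → TraceClass X →ₗ[ℂ] TraceClass X} (hL : ∀ i, IsCP (L i))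
    {S : TraceClass X →ₗ[ℂ] TraceClass X} (h : SumsTo (fun i => ⇑(L i)) S) (F : Finset I) :
    IsCP (S - ∑ i ∈ F, L i) := by
  classical
  intro n ρ hρ ψ
  have h1 : ∀ i j, Tendsto (fun G : Finset I => ⟪ψ i, (((∑ k ∈ G, L k - ∑ k ∈ F, L k) (ρ i j) :
      TraceClass X) : Op X) (ψ j)⟫_ℂ) atTop
      (𝓝 ⟪ψ i, (((S - ∑ k ∈ F, L k) (ρ i j) : TraceClass X) : Op X) (ψ j)⟫_ℂ) := by
    intro i j
    have h2 := ((h (ρ i j)).hasSum.mapL (ContinuousLinearMap.apply ℂ (Ell2 X) (ψ j))).mapL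
      (innerSL ℂ (ψ i))
    simp only [ContinuousLinearMap.apply_apply, innerSL_apply_apply] at h2
    have h3 := Tendsto.sub_const h2
      ⟪ψ i, (((∑ k ∈ F, L k) (ρ i j) : TraceClass X) : Op X) (ψ j)⟫_ℂ
    simpa [LinearMap.sub_apply, inner_sub_right, LinearMap.sum_apply, inner_sum, sum_apply]
      using h3
  refine ge_of_tendsto (tendsto_finsetSum Finset.univ fun i _ =>
    tendsto_finsetSum Finset.univ fun j _ => h1 i j) ?_
  -- Once `G` contains `F`, the difference of the partial sums is the finite sum over `G \ F`, hence
  -- completely positive.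
  filter_upwards [eventually_ge_atTop F] with G hG
  have h4 := IsCP.sum (G \ F) (fun k _ => hL k) n ρ hρ ψ
  have h5 : ∑ k ∈ G, L k - ∑ k ∈ F, L k = ∑ k ∈ G \ F, L k := LinearMap.ext fun σ => by
    rw [LinearMap.sub_apply, LinearMap.sum_apply, LinearMap.sum_apply, LinearMap.sum_apply,
      ← Finset.sum_sdiff hG, add_sub_cancel_right]
  rw [h5]
  exact h4

theorem isCP_of_sumsTo {L : I → TraceClass X →ₗ[ℂ] TraceClass X} (hL : ∀ i, IsCP (L i))
    {S : TraceClass X →ₗ[ℂ] TraceClass X} (h : SumsTo (fun i => ⇑(L i)) S) : IsCP S := by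
  have h1 : S - ∑ i ∈ (∅ : Finset I), L i = S := LinearMap.ext fun ρ => by
    rw [Finset.sum_empty, LinearMap.sub_apply, LinearMap.zero_apply, sub_zero]
  exact h1 ▸ isCP_sub_sum hL h ∅

/-- `tensorId` is defined by choice, so its additivity in the map has to be read off from blocks,
which determine an operator. -/
theorem tensorId_sub_sum {L : I → TraceClass X →ₗ[ℂ] TraceClass X} (hL : ∀ i, IsCP (L i))
    {S : TraceClass X →ₗ[ℂ] TraceClass X} (hS : IsCP S) (F : Finset I) (ρ : TraceClass (X × Y)) :
    tensorId (S - ∑ i ∈ F, L i : TraceClass X →ₗ[ℂ] TraceClass X) ρ =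
      tensorId S ρ - ∑ i ∈ F, tensorId (L i) ρ := by
  refine tensorId_eq fun y y' => ?_
  have h1 : block y y' (tensorId S ρ - ∑ i ∈ F, tensorId (L i) ρ) =
      block y y' (tensorId S ρ) - ∑ i ∈ F, block y y' (tensorId (L i) ρ) := by
    have := map_sub (blockL y y') (tensorId S ρ) (∑ i ∈ F, tensorId (L i) ρ)
    rw [map_sum] at this
    exact this
  rw [h1, block_tensorId hS, LinearMap.sub_apply, LinearMap.sum_apply]
  simp only [block_tensorId (hL _)]

theorem traceNorm_tensorId {E : TraceClass X →ₗ[ℂ] TraceClass X} (hE : IsCP E)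
    {ρ : TraceClass (X × Y)} (hρ : 0 ≤ (ρ : Op (X × Y))) :
    traceNorm (tensorId E ρ : Op (X × Y)) = ∑' y, traceNorm (E (block y y ρ) : Op X) := by
  have h : 0 ≤ (tensorId E ρ : Op (X × Y)) := (isCP_tensorIdL hE).nonneg hρ
  rw [traceNorm_eq_tsum_block h]
  refine tsum_congr fun y => ?_
  rw [← block_tensorId hE]
  rfl

/-- The core of (i). For positive `ρ` the error is a series over the diagonal blocks of `ρ`, treated
by dominated convergence; both sides are linear in `ρ`, which gives the rest. -/
theorem SumsTo.tensorId {L : I → TraceClass X →ₗ[ℂ] TraceClass X} (hL : ∀ i, IsCP (L i))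
    {S : TraceClass X →ₗ[ℂ] TraceClass X} (h : SumsTo (fun i => ⇑(L i)) S) :
    SumsTo (fun i => LocalVar.tensorId (Y := Y) (L i)) (LocalVar.tensorId S) := by
  have hS := isCP_of_sumsTo hL h
  intro ρ
  induction ρ using TraceClass.induction_nonneg with
  | pos ρ hρ =>
    have hb : ∀ y, 0 ≤ (block y y ρ : Op X) := fun y => (isCP_blockL y).nonneg hρ
    have hD := fun F => isCP_sub_sum hL h F
    have h1 : ∀ F : Finset I, traceNorm
        ((∑ i ∈ F, LocalVar.tensorId (L i) ρ - LocalVar.tensorId S ρ : TraceClass (X × Y)) :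
          Op (X × Y)) =
        ∑' y, traceNorm (((S - ∑ i ∈ F, L i) (block y y ρ) : TraceClass X) : Op X) := by
      intro F
      rw [← traceNorm_tensorId (hD F) hρ, tensorId_sub_sum hL hS, ← traceNorm_neg,
        ← Submodule.coe_neg, neg_sub]
    -- On positive operators the remainder lies between `0` and `S`, which supplies the dominating
    -- series.
    have hle : ∀ (F : Finset I) y,
        traceNorm (((S - ∑ i ∈ F, L i) (block y y ρ) : TraceClass X) : Op X) ≤
          traceNorm (S (block y y ρ) : Op X) := by
      intro F y
      refine traceNorm_mono ((hD F).nonneg (hb y)) ?_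
      rw [LinearMap.sub_apply, Submodule.coe_sub]
      exact sub_le_self _ ((IsCP.sum F fun i _ => hL i).nonneg (hb y))
    have hfin : ∑' y, traceNorm (S (block y y ρ) : Op X) ≠ ∞ := by
      rw [← traceNorm_tensorId hS hρ]
      exact (LocalVar.tensorId S ρ).2.ne
    have hpt : ∀ y, Tendsto (fun F : Finset I =>
        traceNorm (((S - ∑ i ∈ F, L i) (block y y ρ) : TraceClass X) : Op X)) atTop (𝓝 0) := by
      intro y
      refine (h (block y y ρ)).congr fun F => ?_
      rw [← traceNorm_neg, ← Submodule.coe_neg, neg_sub, LinearMap.sub_apply, LinearMap.sum_apply]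
    have hfinF : ∀ F : Finset I,
        ∑' y, traceNorm (((S - ∑ i ∈ F, L i) (block y y ρ) : TraceClass X) : Op X) ≠ ∞ := fun F =>
      ((ENNReal.tsum_le_tsum (hle F)).trans_lt hfin.lt_top).ne
    -- For series, dominated convergence holds along an arbitrary filter, so `I` may be uncountable.
    have hlim := tendsto_tsum_of_dominated_convergence (𝓕 := (atTop : Filter (Finset I)))
      (f := fun F y =>
        (traceNorm (((S - ∑ i ∈ F, L i) (block y y ρ) : TraceClass X) : Op X)).toReal)
      (g := fun _ => 0) (ENNReal.summable_toReal hfin)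
      (fun y => (ENNReal.tendsto_toReal ENNReal.zero_ne_top).comp (hpt y))
      (Eventually.of_forall fun F y => by
        rw [Real.norm_of_nonneg ENNReal.toReal_nonneg]
        exact ENNReal.toReal_mono (ENNReal.ne_top_of_tsum_ne_top hfin y) (hle F y))
    rw [tsum_zero] at hlim
    change Tendsto _ _ _
    simp_rw [h1]
    rw [← ENNReal.tendsto_toReal_iff hfinF ENNReal.zero_ne_top]
    refine hlim.congr fun F => ?_
    rw [ENNReal.tsum_toReal_eq fun y => ENNReal.ne_top_of_tsum_ne_top (hfinF F) y]
  | add ρ σ h1 h2 =>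
    have h3 := h1.add h2
    have e := map_add (tensorIdL (Y := Y) hS) ρ σ
    have e' := fun i => map_add (tensorIdL (Y := Y) (hL i)) ρ σ
    change TraceSum (fun i => tensorIdL (hL i) (ρ + σ)) (tensorIdL hS (ρ + σ))
    simp_rw [e, e']
    exact h3
  | smul c ρ h1 =>
    have h3 := h1.smul c
    have e := map_smul (tensorIdL (Y := Y) hS) c ρ
    have e' := fun i => map_smul (tensorIdL (Y := Y) (hL i)) c ρ
    change TraceSum (fun i => tensorIdL (hL i) (c • ρ)) (tensorIdL hS (c • ρ))
    simp_rw [e, e']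
    exact h3

end TraceSum

/-! ### Sums commute with `LOCAL`. -/

section LocalSums

variable {Var : Type u} {T : Var → Type v} {I : Type w}

theorem SumsTo.localVar (init : Mem T) (x : Var)
    {L : I → TraceClass (Mem T) →ₗ[ℂ] TraceClass (Mem T)} (hL : ∀ i, IsCP (L i))
    {S : TraceClass (Mem T) →ₗ[ℂ] TraceClass (Mem T)} (h : SumsTo (fun i => ⇑(L i)) S) :
    SumsTo (fun i => LocalVar.localVar init x (L i)) (LocalVar.localVar init x S) := fun ρ =>
  ((SumsTo.tensorId hL h (swapConj x (tensorPure (init x) ρ))).map (swapConjL x)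
    (traceNorm_sandwichL_le _ _ _ _)).map partialTraceL fun σ =>
      traceNorm_tsum_le (σ : Op (Mem T × T x))

/-- The step for one variable needs completely positive maps as input, so the induction carries
along that every intermediate map is a superoperator. -/
theorem exists_superoperator_localVars (init : Mem T) (xs : List Var)
    (E : I → Superoperator (Mem T)) (S : Superoperator (Mem T)) (h : SumsTo (fun i => ⇑(E i)) S) :
    ∃ (E' : I → Superoperator (Mem T)) (S' : Superoperator (Mem T)),
      (∀ i, localVars init xs (E i) = E' i) ∧ localVars init xs S = S' ∧
        SumsTo (fun i => ⇑(E' i)) S' := by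
  induction xs with
  | nil => exact ⟨E, S, fun _ => rfl, rfl, h⟩
  | cons x xs ih =>
    obtain ⟨E', S', h1, h2, h3⟩ := ih
    refine ⟨fun i => (isCP_localVarL init x (E' i).isCP).toSuperoperator,
      (isCP_localVarL init x S'.isCP).toSuperoperator, fun i => ?_, ?_,
      SumsTo.localVar init x (fun i => (E' i).isCP) h3⟩
    · exact congrArg (LocalVar.localVar init x) (h1 i)
    · exact congrArg (LocalVar.localVar init x) h2

theorem exists_superoperator_sum {X : Type u} (E : I → Superoperator X)
    (h : SumConverges fun i => ⇑(E i)) :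
    ∃ S : Superoperator X, SumsTo (fun i => ⇑(E i)) S := by
  obtain ⟨S, hS⟩ := h
  have hS' : SumsTo (fun i => ⇑(E i).toLinearMap) (sumLinearMap (fun i => (E i).toLinearMap) hS) :=
    hS
  exact ⟨(isCP_of_sumsTo (fun i => (E i).isCP) hS').toSuperoperator, hS⟩

end LocalSums

/-! ### The diverging family with vanishing `LOCAL`. -/

section Counterexample

variable {Var : Type u} {T : Var → Type v}

/-- `E` annihilates the states in which the variable `x` has its default value. -/
def KillsInit (init : Mem T) (x : Var) (E : TraceClass (Mem T) → TraceClass (Mem T)) : Prop :=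
  ∀ ρ : TraceClass (Mem T), (∀ m : Mem T, m x ≠ init x → (ρ : Op (Mem T)) (ket m) = 0) → E ρ = 0

theorem adjoint_basisOp_ket {X : Type u} {Y : Type v} (f : X → Y) (hf : Function.Injective f)
    (x : X) : ContinuousLinearMap.adjoint (basisOp f hf) (ket (f x)) = ket x := by
  classical
  refine ext_inner_ket fun x' => ?_
  rw [ContinuousLinearMap.adjoint_inner_right, basisOp_ket,
    orthonormal_iff_ite.1 ket_orthonormal, orthonormal_iff_ite.1 ket_orthonormal]
  simp [hf.eq_iff]

theorem adjoint_tensorKet_ket_of_ne {X : Type u} {Y : Type v} {y y' : Y} (h : y' ≠ y) (x : X) :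
    ContinuousLinearMap.adjoint (tensorKet y) (ket (x, y')) = 0 := by
  refine ext_inner_ket fun x' => ?_
  rw [ContinuousLinearMap.adjoint_inner_right, tensorKet, basisOp_ket,
    ket_orthonormal.inner_eq_zero (by simp [h.symm]), inner_zero_right]

open Classical in
-- After adjoining `y'`, the swap sends `|m, y'⟩` to `|m[w := y'], m w⟩`, and `ρ ⊗ |init w⟩⟨init w|`
-- kills this unless `m w = init w`. Hence the operators fed to `E` are always in the default state
-- at `w`, and at the other variables they inherit the default state from `ρ`.
theorem block_swapConj_tensorPure_ket (init : Mem T) (w : Var) (ρ : TraceClass (Mem T))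
    (y y' : T w) (m : Mem T)
    (h : m w = init w → (ρ : Op (Mem T)) (ket (Function.update m w y')) = 0) :
    (block y y' (swapConj w (tensorPure (init w) ρ)) : Op (Mem T)) (ket m) = 0 := by
  have h1 : ContinuousLinearMap.adjoint (basisOp (swapMem (T := T) w)
      (swapMem_involutive w).injective) (ket (m, y')) = ket (Function.update m w y', m w) := by
    have := adjoint_basisOp_ket (swapMem (T := T) w) (swapMem_involutive w).injective
      (swapMem w (m, y'))
    rw [swapMem_involutive w] at this
    rw [this, swapMem]
  have h2 : (tensorPure (init w) ρ : Op (Mem T × T w)) (ket (Function.update m w y', m w)) = 0 := by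
    simp only [tensorPure, sandwich, ContinuousLinearMap.comp_apply]
    by_cases hm : m w = init w
    · rw [hm]
      have := adjoint_basisOp_ket (fun m : Mem T => (m, init w)) (Prod.mk_left_injective (init w))
        (Function.update m w y')
      rw [tensorKet, this, h hm, map_zero]
    · rw [adjoint_tensorKet_ket_of_ne hm, map_zero, map_zero]
  have h3 : (tensorKet y' : Ell2 (Mem T) →L[ℂ] Ell2 (Mem T × T w)) (ket m) = ket (m, y') :=
    basisOp_ket _ _ _
  simp only [block, swapConj, sandwich, ContinuousLinearMap.comp_apply]
  rw [h3, h1, h2, map_zero, map_zero]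

/-- The zero operator witnesses the existence in `tensorId`, so `E` may be any function and no
complete positivity has to be tracked. -/
theorem localVar_eq_zero (init : Mem T) (w : Var) {E : TraceClass (Mem T) → TraceClass (Mem T)}
    {ρ : TraceClass (Mem T)}
    (h : ∀ y y', E (block y y' (swapConj w (tensorPure (init w) ρ))) = 0) :
    localVar init w E ρ = 0 := by
  have h1 : tensorId E (swapConj w (tensorPure (init w) ρ)) = 0 := tensorId_eq fun y y' => by
    rw [h]
    exact map_zero (blockL y y')
  rw [localVar, h1]
  exact map_zero (partialTraceL ∘ₗ swapConjL w)

theorem KillsInit.localVar {init : Mem T} {x : Var} {E : TraceClass (Mem T) → TraceClass (Mem T)}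
    (hE : KillsInit init x E) (w : Var) : KillsInit init x (LocalVar.localVar init w E) := by
  classical
  intro ρ hρ
  refine localVar_eq_zero init w fun y y' => hE _ fun m hm => ?_
  refine block_swapConj_tensorPure_ket init w ρ y y' m fun hw => hρ _ ?_
  have hxw : x ≠ w := by
    rintro rfl
    exact hm hw
  convert hm using 1
  exact Function.update_of_ne hxw _ _

theorem KillsInit.localVar_self {init : Mem T} {x : Var}
    {E : TraceClass (Mem T) → TraceClass (Mem T)} (hE : KillsInit init x E)
    (ρ : TraceClass (Mem T)) : LocalVar.localVar init x E ρ = 0 :=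
  localVar_eq_zero init x fun y y' => hE _ fun m hm =>
    block_swapConj_tensorPure_ket init x ρ y y' m fun h => absurd h hm

theorem KillsInit.localVars {init : Mem T} {x : Var} {E : TraceClass (Mem T) → TraceClass (Mem T)}
    (hE : KillsInit init x E) (xs : List Var) :
    KillsInit init x (LocalVar.localVars init xs E) := by
  induction xs with
  | nil => exact hE
  | cons w xs ih => exact ih.localVar w

/-- At the occurrence of `x` the map becomes zero, since `KillsInit` has survived the variables
further inside; the variables further outside keep it zero. -/
theorem KillsInit.localVars_of_mem {init : Mem T} {x : Var}
    {E : TraceClass (Mem T) → TraceClass (Mem T)} (hE : KillsInit init x E) {xs : List Var}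
    (hx : x ∈ xs) (ρ : TraceClass (Mem T)) : LocalVar.localVars init xs E ρ = 0 := by
  induction xs generalizing ρ with
  | nil => simp at hx
  | cons w xs ih =>
    rcases List.mem_cons.1 hx with rfl | hx
    · exact (hE.localVars xs).localVar_self ρ
    · exact localVar_eq_zero init w fun y y' => ih hx _

/-- The projection `|z⟩⟨z|`. -/
def ketProj {X : Type u} (z : X) : Op X := InnerProductSpace.rankOne ℂ (ket z) (ket z)

theorem ketProj_apply {X : Type u} (z : X) (f : Ell2 X) : ketProj z f = ⟪ket z, f⟫_ℂ • ket z :=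
  InnerProductSpace.rankOne_apply _ _ _

theorem ketProj_norm_le {X : Type u} (z : X) : ‖ketProj z‖ ≤ 1 := by
  rw [ketProj, InnerProductSpace.norm_rankOne, ket_orthonormal.1 z, one_mul]

theorem ketProj_mem {X : Type u} (z : X) : ketProj z ∈ TraceClass X := by
  change traceNorm _ < ∞
  have h : 0 ≤ ketProj z := (ContinuousLinearMap.nonneg_iff_isPositive _).2
    (InnerProductSpace.isPositive_rankOne_self _)
  rw [traceNorm_of_nonneg h, tsum_eq_single z]
  · exact ENNReal.ofReal_lt_top
  · intro x hx
    rw [ketProj_apply, ket_orthonormal.inner_eq_zero hx.symm, zero_smul, inner_zero_right]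
    simp

/-- The superoperator `ρ ↦ |z⟩⟨z| ρ |z⟩⟨z|`. -/
def ketProjSuper {X : Type u} (z : X) : Superoperator X :=
  (isCP_sandwichL (ketProj z) (ketProj_norm_le z)).toSuperoperator

theorem inner_ketProjSuper {X : Type u} (z : X) (ρ : TraceClass X) (f g : Ell2 X) :
    ⟪f, (ketProjSuper z ρ : Op X) g⟫_ℂ = ⟪ketProj z f, (ρ : Op X) (ketProj z g)⟫_ℂ := by
  change ⟪f, ContinuousLinearMap.adjoint (ketProj z) ((ρ : Op X) (ketProj z g))⟫_ℂ = _
  rw [ContinuousLinearMap.adjoint_inner_right]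

theorem killsInit_ketProjSuper (init : Mem T) {x : Var} {z : Mem T} (hz : z x ≠ init x) :
    KillsInit init x (ketProjSuper z) := by
  intro ρ hρ
  refine Subtype.ext (ContinuousLinearMap.ext fun g => ext_inner_left ℂ fun f => ?_)
  rw [inner_ketProjSuper, ketProj_apply z g, map_smul, hρ z hz]
  simp

theorem not_sumConverges_ketProjSuper {X : Type u} (z : X) {I : Type w} [Infinite I] :
    ¬ SumConverges (fun _ : I => ⇑(ketProjSuper z)) := by
  rintro ⟨S, hS⟩
  have h1 := (hS ⟨ketProj z, ketProj_mem z⟩).hasSum.summable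
  -- A constant family over an infinite set is summable only if the constant vanishes, but here it
  -- is `|z⟩⟨z|`, with diagonal coefficient `1` at `z`.
  rw [summable_const_iff] at h1
  have h2 := inner_ketProjSuper z ⟨ketProj z, ketProj_mem z⟩ (ket z) (ket z)
  rw [h1] at h2
  have h3 : (ket z : Ell2 X) ≠ 0 := ket_orthonormal.ne_zero z
  simp [ketProj_apply, h3] at h2

end Counterexample

end

end LocalVar

theorem mainTheorem11 {Var : Type*} {T : Var → Type*} (init : ∀ x, T x) (xs : List Var)
    {I : Type*} :
    (∀ E : I → Superoperator (Mem T), SumConverges (fun i => ⇑(E i)) →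
      ∃ S : Superoperator (Mem T), SumsTo (fun i => ⇑(E i)) S ∧
        SumsTo (fun i => localVars init xs (E i)) (localVars init xs S)) ∧
    (Infinite I → (∃ x ∈ xs, Nontrivial (T x)) →
      ∃ E : I → Superoperator (Mem T), (∀ i ρ, localVars init xs (E i) ρ = 0) ∧
        SumConverges (fun i => localVars init xs (E i)) ∧ ¬ SumConverges (fun i => ⇑(E i))) := by
  classical
  refine ⟨fun E hE => ?_, fun hI ⟨x, hx, hT⟩ => ?_⟩
  · obtain ⟨S, hS⟩ := exists_superoperator_sum E hE
    obtain ⟨E', S', h1, h2, h3⟩ := exists_superoperator_localVars init xs E S hS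
    refine ⟨S, hS, ?_⟩
    simp_rw [h1, h2]
    exact h3
  · obtain ⟨y, hy⟩ := exists_ne (init x)
    have hz : Function.update init x y x ≠ init x := by simpa using hy
    have h0 : ∀ ρ, localVars init xs (ketProjSuper (Function.update init x y)) ρ = 0 :=
      (killsInit_ketProjSuper init hz).localVars_of_mem hx
    refine ⟨fun _ => ketProjSuper (Function.update init x y), fun _ => h0,
      ⟨fun _ => 0, fun ρ => ?_⟩, not_sumConverges_ketProjSuper _⟩
    simp [TraceSum, h0, traceNorm_zero]
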